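/- **Setting.** Let $h>0$ and $k,n\in\mathbb N=\{1,2,\dots\}$. $C_n$ and $C^1_n$ are the spaces of continuous, respectively continuously differentiable, maps $[-h,0]\to\mathbb R^n$ with the norms $\max|\phi|$ and $\max|\phi|+\max|\phi'|$ (Euclidean norm on $\mathbb R^n$); $C=C_1$, $C^1=C^1_1$, $|\cdot|_C$ is the norm of $C$, and $X_0=\{\psi\in C^1_n:\psi'(0)=0\}$. Let $I$ be an open interval and $J$ a compact interval with $[-h,0]\subset I\subset J\subset[-2h,h]$. For $\phi\in C$ let $E\phi:J\to\mathbb R$ be the odd extension: $E\phi(t)=\phi(t)$ on $[-h,0]$, $E\phi(t)=2\phi(-h)-\phi(-t-2h)$ for $t\le -h$, $E\phi(t)=2\phi(0)-\phi(-t)$ for $t\ge0$. For $(r,\phi)\in J^k\times C_n$ let $\widehat{(r,\phi)}\in\mathbb R^{kn}$ be the vector with components $E\phi_j(r_\kappa)$ at $\iota=(\kappa-1)n+j$, $1\le\kappa\le k$, $1\le j\le n$. Let $F$ be a finite-dimensional real normed space, let $V\subset\mathbb R^{kn}$ and $W\subset F$ be open, and let $g:V\to\mathbb R^n$ be continuously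 differentiable. Let $\delta:J^k\times W\to\mathbb R^k$ and $Q:J^k\times C_n\to F$ be continuous, with continuously differentiable restrictions to $I^k\times W$ and to $I^k\times C^1_n$, respectively, and with $Q(r,\cdot)$ linear for every $r\in J^k$. For $j=1,\dots,n$ put $Q_j(r,\phi)=Q(r,\phi\cdot e_j)$ for $(r,\phi)\in J^k\times C$, where $\phi\cdot e_j\in C_n$ has $j$-th component $\phi$ and all other components $0$. Assume that each $q=Q_j$ satisfies: the range $F_q$ of $q(r,\cdot)$ is the same for all $r\in J^k$, and either $F_q=0$ or there are $\beta_1,\dots,\beta_d\in C$, $d=\dim F_q$, such that for every $r\in J^k$ the vectors $q(r,\beta_1),\dots,q(r,\beta_d)$ form a basis of $F_q$. Put $$\mathcal U=\{(r,\phi)\in I^k\times C^1_n:\widehat{(r,\phi)}\in V,\ Q(r,\phi)\in W\},$$ assume $\mathcal U\ne\emptyset$, and let $$G(r,\phi)=g(\widehat{(r,\phi)})\ \text{ for }(r,\phi)\in\mathcal U,\qquad \Delta(r,\phi)=\delta(r,Q(r,\phi))\ \text{ for }(r,\phi)\in I^k\times C^1_n\text{ with }Q(r,\phi)\in W,$$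 $$M_{G,\Delta}=\{(r,\phi)\in\mathcal U:\phi'(0)=G(r,\phi),\ \Delta(r,\phi)=0,\ \det D_1\Delta(r,\phi)\ne0\}.$$ **The map $T$.** For $v\in V$ let $$h_g(v)=\frac{m(v)}{6kn\,(1+\max_{\iota,j}|\partial_\iota g_j(v)|+\max_j|g_j(v)|)},$$ where $m(v)=\min\{1,\mathrm{dist}(v,\mathbb R^{kn}\setminus V)\}$ if $V\ne\mathbb R^{kn}$ and $m(v)=1$ if $V=\mathbb R^{kn}$. Call continuously differentiable maps $\chi_1,\dots,\chi_n:I^k\times V\to C^1$ *admissible* if for all $j$, all $(r,v)\in I^k\times V$ and all $\nu\in\{1,\dots,kn\}$ $$Q_j(r,\chi_j(r,v))=0,\quad[\chi_j(r,v)]'(0)=1,\quad|\chi_j(r,v)|_C\le h_g(v),\quad\Big|\frac{\partial\chi_j}{\partial v_\nu}(r,v)\Big|_C\le h_g(v).$$ Given such maps, define for $(r,\phi)\in\mathcal U$ $$T(r,\phi)=\Big(r,\ \phi-\big(g_1(v)\chi_1(r,v),\dots,g_n(v)\chi_n(r,v)\big)\Big),\qquad v=\widehat{(r,\phi)},$$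 and define for $r\in I^k$ the map $S_r:V\to\mathbb R^{kn}$ with components $(S_r(v))_\iota=v_\iota-g_j(v)\,(E\chi_j(r,v))(r_\kappa)$, $\iota=(\kappa-1)n+j$, and $$\mathcal O=\{(r,\psi)\in I^k\times C^1_n:\ Q(r,\psi)\in W,\ \widehat{(r,\psi)}\in S_r(V)\}.$$ **Corollary 4.4.** Admissible maps $\chi_1,\dots,\chi_n$ exist. For every choice of them, $\mathcal U$ and $\mathcal O$ are open in $\mathbb R^k\times C^1_n$, $T$ is a $C^1$-diffeomorphism of $\mathcal U$ onto $\mathcal O$ (a bijection, continuously differentiable together with its inverse), and $$\begin{aligned}T(M_{G,\Delta})&=\{(r,\psi)\in\mathcal O:\psi'(0)=0,\ \Delta(r,\psi)=0,\ \det D_1\Delta(T^{-1}(r,\psi))\ne0\}\\&=\{(r,\psi)\in(I^k\times X_0)\cap\mathcal O:\Delta(r,\psi)=0,\ \det D_1\Delta(T^{-1}(r,\psi))\ne0\}.\end{aligned}$$ So the solution manifold is mapped by the diffeomorphism $T$ into the strip $I^k\times X_0$, and its image is cut out there within $\mathcal O$, up to the regularity condition $\det D_1\Delta(T^{-1}(r,\psi))\ne0$,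 only by the algebraic equation $\Delta=0$. -/

import Mathlib

open Set

noncomputable section

namespace AlgDelay

/-- The interval `[-h, 0]`. -/
abbrev K (h : ℝ) : Set ℝ := Icc (-h) 0

/-- `C([-h,0], E)` with the maximum norm. -/
abbrev C0 (h : ℝ) (E : Type*) [NormedAddCommGroup E] [NormedSpace ℝ E] : Type _ := C(K h, E)

/-- `ℝ^m` with the Euclidean norm. -/
abbrev Rn (m : ℕ) : Type := EuclideanSpace ℝ (Fin m)

/-- `ℝ^{kn}` with the Euclidean norm. The coordinate number `(κ - 1) n + j` is written as the pair
`(κ, j)`. -/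
abbrev Rkn (k n : ℕ) : Type := EuclideanSpace ℝ (Fin k × Fin n)

/-- The value of `φ ∈ C([-h,0], E)` at a real number `t`; it is `φ(t)` for `t ∈ [-h,0]`, and the
(never used) value `0` elsewhere. -/
def ev {h : ℝ} {E : Type*} [NormedAddCommGroup E] [NormedSpace ℝ E] (φ : C0 h E) (t : ℝ) : E :=
  open Classical in if ht : t ∈ K h then φ ⟨t, ht⟩ else 0

theorem ev_add {h : ℝ} {E : Type*} [NormedAddCommGroup E] [NormedSpace ℝ E] (φ ψ : C0 h E) :
    ev (φ + ψ) = ev φ + ev ψ := by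
  funext t
  by_cases ht : t ∈ K h <;> simp [ev, ht]

theorem ev_smul {h : ℝ} {E : Type*} [NormedAddCommGroup E] [NormedSpace ℝ E] (c : ℝ)
    (φ : C0 h E) : ev (c • φ) = c • ev φ := by
  funext t
  by_cases ht : t ∈ K h <;> simp [ev, ht]

theorem ev_zero {h : ℝ} {E : Type*} [NormedAddCommGroup E] [NormedSpace ℝ E] :
    ev (0 : C0 h E) = 0 := by
  funext t
  by_cases ht : t ∈ K h <;> simp [ev, ht]

/-- The continuously differentiable maps `[-h,0] → E`, as the space of all pairs `(φ, φ')` of a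
continuous map and its continuous derivative (one-sided at the endpoints). It carries the norm
`max |φ| + max |φ'|`. -/
def C1Submodule (h : ℝ) (E : Type*) [NormedAddCommGroup E] [NormedSpace ℝ E] :
    Submodule ℝ (WithLp 1 (C0 h E × C0 h E)) where
  carrier := {p | ∀ t ∈ K h, HasDerivWithinAt (ev p.fst) (ev p.snd t) (K h) t}
  add_mem' := by
    intro p q hp hq t ht
    have := (hp t ht).add (hq t ht)
    simpa [ev_add] using this
  zero_mem' := by
    intro t _
    show HasDerivWithinAt (ev (0 : C0 h E)) (ev (0 : C0 h E) t) (K h) t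
    rw [ev_zero]
    exact hasDerivWithinAt_const t (K h) (0 : E)
  smul_mem' := by
    intro c p hp t ht
    have := (hp t ht).const_smul c
    simpa [ev_smul] using this

/-- The normed space `C¹([-h,0], E)` with the norm `max |φ| + max |φ'|`. -/
abbrev C1 (h : ℝ) (E : Type*) [NormedAddCommGroup E] [NormedSpace ℝ E] : Type _ :=
  ↥(C1Submodule h E)

/-- The inclusion `C¹ → C`. -/
def incl {h : ℝ} {E : Type*} [NormedAddCommGroup E] [NormedSpace ℝ E] (φ : C1 h E) : C0 h E :=
  φ.1.fst

/-- The derivative `φ' ∈ C` of `φ ∈ C¹`. -/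
def der {h : ℝ} {E : Type*} [NormedAddCommGroup E] [NormedSpace ℝ E] (φ : C1 h E) : C0 h E :=
  φ.1.snd

/-- The component `φ_j ∈ C([-h,0], ℝ)` of `φ ∈ C([-h,0], ℝⁿ)`. -/
def comp {h : ℝ} {n : ℕ} (φ : C0 h (Rn n)) (j : Fin n) : C0 h ℝ :=
  ⟨fun t => φ t j, by fun_prop⟩

/-- The element of `C([-h,0], ℝⁿ)` with the given components. -/
def vec {h : ℝ} {n : ℕ} (f : Fin n → C0 h ℝ) : C0 h (Rn n) :=
  ⟨fun t => WithLp.toLp 2 (fun j => f j t), by fun_prop⟩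

theorem ev_vec {h : ℝ} {n : ℕ} (f : Fin n → C0 h ℝ) (t : ℝ) :
    ev (vec f) t = WithLp.toLp 2 (fun j => ev (f j) t) := by
  by_cases ht : t ∈ K h
  · simp [ev, ht, vec]
  · simp only [ev, ht, dite_false]
    rfl

/-- The element of `C¹([-h,0], ℝⁿ)` with the given components. -/
def vec1 {h : ℝ} {n : ℕ} (f : Fin n → C1 h ℝ) : C1 h (Rn n) :=
  ⟨WithLp.toLp 1 (vec fun j => incl (f j), vec fun j => der (f j)), by
    intro t ht
    have h1 : HasDerivWithinAt (fun t => fun j => ev (incl (f j)) t)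
        (fun j => ev (der (f j)) t) (K h) t := by
      rw [hasDerivWithinAt_pi]
      intro j
      exact (f j).2 t ht
    have h2 := ((PiLp.continuousLinearEquiv 2 ℝ (fun _ : Fin n => ℝ)).symm
      |>.toContinuousLinearMap.hasFDerivAt).comp_hasDerivWithinAt t h1
    have e : ev (vec fun j => incl (f j))
        = fun t => WithLp.toLp 2 (fun j => ev (incl (f j)) t) := by
      funext s
      exact ev_vec _ s
    show HasDerivWithinAt (ev (vec fun j => incl (f j))) (ev (vec fun j => der (f j)) t) (K h) t
    rw [e, ev_vec]
    exact h2⟩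

/-- The odd extension `Eφ` of `φ ∈ C([-h,0], ℝ)`; only its values on `[-2h, h]` are used. -/
def oddExt {h : ℝ} (φ : C0 h ℝ) (t : ℝ) : ℝ :=
  if t < -h then 2 * ev φ (-h) - ev φ (-t - 2 * h)
  else if t ≤ 0 then ev φ t
  else 2 * ev φ 0 - ev φ (-t)

/-- The vector of all `Eφ_j(r_κ)`. -/
def hat {h : ℝ} {k n : ℕ} (r : Rn k) (φ : C0 h (Rn n)) : Rkn k n :=
  WithLp.toLp 2 fun i => oddExt (comp φ i.2) (r i.1)

/-- The cube `I^k`. -/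
def cube (k : ℕ) (I : Set ℝ) : Set (Rn k) := {r | ∀ κ, r κ ∈ I}

/-- The hyperspace `X₀ = {χ ∈ C¹_n : χ'(0) = 0}`. -/
def X0 (h : ℝ) (n : ℕ) : Set (C1 h (Rn n)) := {ψ | ev (der ψ) 0 = 0}

/-- Condition (Hq) on a map `q : J^k × C → F`: the range of `q(r,·)` is one and the same subspace
`F_q` for all `r ∈ J^k`, and either `F_q = 0`, or there are `β_1, …, β_d ∈ C`, `d = dim F_q`, such
that `q(r,β_1), …, q(r,β_d)` form a basis of `F_q` for every `r ∈ J^k`. -/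
def Hq {h : ℝ} {k : ℕ} {F : Type*} [NormedAddCommGroup F] [NormedSpace ℝ F] (J : Set ℝ)
    (q : Rn k → C0 h ℝ → F) : Prop :=
  ∃ Fq : Submodule ℝ F, (∀ r ∈ cube k J, range (q r) = Fq) ∧
    (Fq = ⊥ ∨ ∃ β : Fin (Module.finrank ℝ Fq) → C0 h ℝ, ∀ r ∈ cube k J,
      LinearIndependent ℝ (fun m => q r (β m)) ∧
      Submodule.span ℝ (range fun m => q r (β m)) = Fq)

/-- The data of an algebraic-delay system `x'(t) = g((r(t), x_t)^)`, `0 = δ(r(t), Q(r(t), x_t))`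
with their standing assumptions. The maps `g`, `δ`, `Q` are total functions of which only the values
on `V`, `J^k × W`, `J^k × C_n` matter. -/
structure System (h : ℝ) (n k : ℕ) (F : Type*) [NormedAddCommGroup F] [NormedSpace ℝ F] where
  /-- the endpoints of the open interval `I` -/
  (a b : ℝ)
  /-- the endpoints of the compact interval `J` -/
  (c d : ℝ)
  V : Set (Rkn k n)
  W : Set F
  g : Rkn k n → Rn n
  δ : Rn k × F → Rn k
  Q : Rn k × C0 h (Rn n) → F
  subset_I : Icc (-h) 0 ⊆ Ioo a b
  I_subset_J : Ioo a b ⊆ Icc c d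
  J_subset : Icc c d ⊆ Icc (-2 * h) h
  isOpen_V : IsOpen V
  isOpen_W : IsOpen W
  contDiffOn_g : ContDiffOn ℝ 1 g V
  continuousOn_δ : ContinuousOn δ (cube k (Icc c d) ×ˢ W)
  contDiffOn_δ : ContDiffOn ℝ 1 δ (cube k (Ioo a b) ×ˢ W)
  continuousOn_Q : ContinuousOn Q (cube k (Icc c d) ×ˢ univ)
  linear_Q : ∀ r ∈ cube k (Icc c d), IsLinearMap ℝ fun φ => Q (r, φ)
  contDiffOn_Q : ContDiffOn ℝ 1 (fun p : Rn k × C1 h (Rn n) => Q (p.1, incl p.2))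
    (cube k (Ioo a b) ×ˢ univ)
  /-- condition (Hq) for the maps `Q_j(r,φ) = Q(r, φ · e_j)` -/
  hq : ∀ j : Fin n, Hq (Icc c d) fun r φ => Q (r, vec (Pi.single j φ))
  /-- the domain of the system is not empty -/
  nonempty : ∃ r ∈ cube k (Ioo a b), ∃ φ : C1 h (Rn n), hat r (incl φ) ∈ V ∧ Q (r, incl φ) ∈ W

namespace System

variable {h : ℝ} {n k : ℕ} {F : Type*} [NormedAddCommGroup F] [NormedSpace ℝ F]
  (S : System h n k F)

/-- The open cube `I^k`. -/
def Ik : Set (Rn k) := cube k (Ioo S.a S.b)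

/-- The domain `𝒰`. -/
def U : Set (Rn k × C1 h (Rn n)) :=
  {p | p.1 ∈ S.Ik ∧ hat p.1 (incl p.2) ∈ S.V ∧ S.Q (p.1, incl p.2) ∈ S.W}

/-- `G(r,φ) = g((r,φ)^)`. -/
def G (p : Rn k × C1 h (Rn n)) : Rn n := S.g (hat p.1 (incl p.2))

/-- `Δ(r,φ) = δ(r, Q(r,φ))`. -/
def Delta (p : Rn k × C1 h (Rn n)) : Rn k := S.δ (p.1, S.Q (p.1, incl p.2))

/-- The partial derivative `D_1Δ(r,φ) : ℝ^k → ℝ^k`. -/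
def D1Delta (p : Rn k × C1 h (Rn n)) : Rn k →L[ℝ] Rn k :=
  fderiv ℝ (fun s => S.Delta (s, p.2)) p.1

/-- The solution manifold `M_{G,Δ}`. -/
def M : Set (Rn k × C1 h (Rn n)) :=
  {p | p ∈ S.U ∧ ev (der p.2) 0 = S.G p ∧ S.Delta p = 0 ∧ (S.D1Delta p).det ≠ 0}

/-- The function `h_g : V → (0,∞)`. -/
def hg (v : Rkn k n) : ℝ :=
  open Classical in
  (if S.V = univ then 1 else min 1 (Metric.infDist v S.Vᶜ)) /
    (6 * k * n * (1 + (⨆ i : (Fin k × Fin n) × Fin n,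
      |fderiv ℝ S.g v (EuclideanSpace.single i.1 1) i.2|) + ⨆ j : Fin n, |S.g v j|))

/-- The properties required of the maps `χ_{g,j} : I^k × V → C¹`, `j = 1, …, n`. -/
structure IsAdmissible (χ : Fin n → Rn k × Rkn k n → C1 h ℝ) : Prop where
  contDiffOn : ∀ j, ContDiffOn ℝ 1 (χ j) (S.Ik ×ˢ S.V)
  Q_eq_zero : ∀ j, ∀ r ∈ S.Ik, ∀ v ∈ S.V, S.Q (r, vec (Pi.single j (incl (χ j (r, v))))) = 0
  der_eq_one : ∀ j, ∀ r ∈ S.Ik, ∀ v ∈ S.V, ev (der (χ j (r, v))) 0 = 1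
  norm_le : ∀ j, ∀ r ∈ S.Ik, ∀ v ∈ S.V, ‖incl (χ j (r, v))‖ ≤ S.hg v
  norm_partial_le : ∀ j, ∀ r ∈ S.Ik, ∀ v ∈ S.V, ∀ ν,
    ‖incl (fderiv ℝ (fun w => χ j (r, w)) v (EuclideanSpace.single ν 1))‖ ≤ S.hg v

/-- `T(r,φ) = (r, φ - g(v) ⊙ χ_g(r,v))` with `v = (r,φ)^`, where `g(v) ⊙ χ_g(r,v)` has the
components `g_j(v) χ_{g,j}(r,v)`. -/
def T (χ : Fin n → Rn k × Rkn k n → C1 h ℝ) (p : Rn k × C1 h (Rn n)) : Rn k × C1 h (Rn n) :=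
  (p.1, p.2 - vec1 fun j =>
    S.g (hat p.1 (incl p.2)) j • χ j (p.1, hat p.1 (incl p.2)))

/-- `S_r(v) = v - R(r,v)`, where `R(r,v)` has the components `g_j(v) (E χ_{g,j}(r,v))(r_κ)`. -/
def Smap (χ : Fin n → Rn k × Rkn k n → C1 h ℝ) (r : Rn k) (v : Rkn k n) : Rkn k n :=
  v - WithLp.toLp 2 fun i => S.g v i.2 * oddExt (incl (χ i.2 (r, v))) (r i.1)

/-- The set `𝒪 = {(r,ψ) ∈ I^k × C¹_n : Q(r,ψ) ∈ W, (r,ψ)^ ∈ S_r(V)}`. -/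
def O (χ : Fin n → Rn k × Rkn k n → C1 h ℝ) : Set (Rn k × C1 h (Rn n)) :=
  {p | p.1 ∈ S.Ik ∧ S.Q (p.1, incl p.2) ∈ S.W ∧ hat p.1 (incl p.2) ∈ S.Smap χ p.1 '' S.V}

end System

end AlgDelay

end

noncomputable section

namespace AlgDelay

open Filter Topology

/-! The map `T` subtracts from `φ` the function `shift` with components `g_j(v) χ_j(r,v)`, where `v`
is the delayed vector `hat r φ`. This function lies in the kernel of `Q(r,·)`, so `Q`, and with it
`Delta`, is unchanged by `T` (`Q_T`, `Delta_T`). Its derivative at `0` is `g(v)`, so the condition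
`φ'(0) = G(r,φ)` becomes `ψ'(0) = 0` (`ev_der_T`). The description of the image of the manifold
follows as soon as `T` is invertible.

Inverting `T` is a finite-dimensional problem. On delayed vectors `T` acts as `S_r(v) = v - R(r,v)`
(`hat_T`), and once `v` is known, `φ` is recovered by adding the shift back. The bounds by `h_g`
make `R` smaller than half the margin of `v` in `V` and its derivative in `v` at most `1/2`. Hence
`S_r` is injective on `V` (`injOn_Smap`), and the inverse function theorem makes `(r,v) ↦ (r,
S_r(v))` a diffeomorphism onto an open set (`exists_Smap_diffeo`). Smoothness of `T` and its inverse
also needs `(φ,t) ↦ Eφ(t)` to be `C¹` on `C¹ × (-2h,h)` (`contDiffOn_oddExt`), which holds because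
the odd extension of a `C¹` function is `C¹`.

Admissible maps come from `t ↦ t exp(a t)`, which has slope `1` at `0` and maximum norm at most
`1/a`. Take `a = 1/s(v)` with a `C¹` function `s` such that `s` and its derivative lie below a
multiple of `h_g` (`exists_contDiff_minorant`). A linear corrector then moves the function into the
kernel of `q(r,·)` without changing the slope at `0`, at the cost of a constant factor in the
maximum norm that is uniform in `r` (`Hq.exists_corrector`). -/

theorem compactSpace_K (h : ℝ) : CompactSpace (K h) := inferInstance

attribute [local instance] compactSpace_K

theorem contDiffOn_one_of_hasFDerivAt {E G : Type*} [NormedAddCommGroup E] [NormedSpace ℝ E]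
    [NormedAddCommGroup G] [NormedSpace ℝ G] {f : E → G} {f' : E → E →L[ℝ] G} {s : Set E}
    (hs : IsOpen s) (hf : ∀ x ∈ s, HasFDerivAt f (f' x) x) (hf' : ContinuousOn f' s) :
    ContDiffOn ℝ 1 f s := by
  have := (contDiffOn_succ_iff_fderiv_of_isOpen (𝕜 := ℝ) (f := f) (n := 0) hs).2
    ⟨fun x hx => (hf x hx).differentiableAt.differentiableWithinAt, by simp, by
      rw [contDiffOn_zero]
      exact hf'.congr fun x hx => (hf x hx).fderiv⟩
  simpa using this

/-! ### Evaluation and odd extension as bounded functionals -/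

section Basic

variable {h : ℝ} {E : Type*} [NormedAddCommGroup E] [NormedSpace ℝ E]

/-- The inclusion `C¹ → C` as a continuous linear map. -/
def inclL (h : ℝ) (E : Type*) [NormedAddCommGroup E] [NormedSpace ℝ E] :
    C1 h E →L[ℝ] C0 h E :=
  (WithLp.fstL 1 ℝ _ _).comp (C1Submodule h E).subtypeL

/-- Differentiation `C¹ → C` as a continuous linear map. -/
def derL (h : ℝ) (E : Type*) [NormedAddCommGroup E] [NormedSpace ℝ E] :
    C1 h E →L[ℝ] C0 h E :=
  (WithLp.sndL 1 ℝ _ _).comp (C1Submodule h E).subtypeL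

@[simp] theorem inclL_apply (φ : C1 h E) : inclL h E φ = incl φ := rfl

@[simp] theorem derL_apply (φ : C1 h E) : derL h E φ = der φ := rfl

theorem norm_eq_incl_add_der (φ : C1 h E) : ‖φ‖ = ‖incl φ‖ + ‖der φ‖ :=
  WithLp.prod_norm_eq_of_L1 φ.1

theorem norm_der_le (φ : C1 h E) : ‖der φ‖ ≤ ‖φ‖ := by
  rw [norm_eq_incl_add_der]; linarith [norm_nonneg (incl φ)]

theorem ev_of_mem (φ : C0 h E) {t : ℝ} (ht : t ∈ K h) : ev φ t = φ ⟨t, ht⟩ := by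
  simp [ev, ht]

theorem norm_ev_le (φ : C0 h E) (t : ℝ) : ‖ev φ t‖ ≤ ‖φ‖ := by
  by_cases ht : t ∈ K h
  · rw [ev_of_mem φ ht]; exact φ.norm_coe_le_norm _
  · simp [ev, ht]

/-- Evaluation at `t` as a continuous linear functional. -/
def evL (h : ℝ) (E : Type*) [NormedAddCommGroup E] [NormedSpace ℝ E] (t : ℝ) : C0 h E →L[ℝ] E :=
  LinearMap.mkContinuous
    { toFun := fun φ => ev φ t
      map_add' := fun φ ψ => by rw [ev_add]; rfl
      map_smul' := fun c φ => by rw [ev_smul]; rfl } 1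
    fun φ => by simpa using norm_ev_le φ t

@[simp] theorem evL_apply (φ : C0 h E) (t : ℝ) : evL h E t φ = ev φ t := rfl

/-- The odd extension evaluated at `t`, as a continuous linear functional. -/
def oddL (h : ℝ) (t : ℝ) : C0 h ℝ →L[ℝ] ℝ :=
  if t < -h then (2 : ℝ) • evL h ℝ (-h) - evL h ℝ (-t - 2 * h)
  else if t ≤ 0 then evL h ℝ t
  else (2 : ℝ) • evL h ℝ 0 - evL h ℝ (-t)

@[simp] theorem oddL_apply (φ : C0 h ℝ) (t : ℝ) : oddL h t φ = oddExt φ t := by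
  unfold oddL oddExt
  split_ifs <;> simp

theorem abs_oddExt_le (φ : C0 h ℝ) (t : ℝ) : |oddExt φ t| ≤ 3 * ‖φ‖ := by
  have key (t : ℝ) : |ev φ t| ≤ ‖φ‖ := norm_ev_le φ t
  have h0 := norm_nonneg φ
  unfold oddExt
  split_ifs
  · have := abs_le.1 (key (-h)); have := abs_le.1 (key (-t - 2 * h))
    rw [abs_le]; constructor <;> linarith
  · linarith [key t]
  · have := abs_le.1 (key 0); have := abs_le.1 (key (-t))
    rw [abs_le]; constructor <;> linarith

end Basic

/-! ### Joint smoothness of the odd extension -/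

section OddExtension

variable {h : ℝ}

/-- The folding of `[-2h, h]` onto `[-h, 0]` by reflection at the endpoints. -/
def fold (h t : ℝ) : ℝ := -|(|t + h| - h)|

theorem continuous_fold (h : ℝ) : Continuous (fold h) := by
  unfold fold; fun_prop

theorem fold_left {t : ℝ} (ht : t ∈ Icc (-2 * h) (-h)) : fold h t = -t - 2 * h := by
  unfold fold
  have h1 := ht.1
  rw [abs_of_nonpos (by linarith [ht.2] : t + h ≤ 0),
    abs_of_nonpos (by linarith : -(t + h) - h ≤ 0)]
  ring

theorem fold_mid {t : ℝ} (ht : t ∈ Icc (-h) 0) : fold h t = t := by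
  unfold fold
  rw [abs_of_nonneg (by linarith [ht.1] : 0 ≤ t + h), add_sub_cancel_right,
    abs_of_nonpos ht.2, neg_neg]

theorem fold_right (hh : 0 < h) {t : ℝ} (ht : t ∈ Icc 0 h) : fold h t = -t := by
  unfold fold
  rw [abs_of_nonneg (by linarith [ht.1] : 0 ≤ t + h), add_sub_cancel_right, abs_of_nonneg ht.1]

theorem fold_mem (hh : 0 < h) {t : ℝ} (ht : t ∈ Icc (-2 * h) h) : fold h t ∈ K h := by
  rcases le_total t (-h) with h1 | h1
  · rw [fold_left ⟨ht.1, h1⟩]; constructor <;> linarith [ht.1]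
  rcases le_total t 0 with h2 | h2
  · rw [fold_mid ⟨h1, h2⟩]; exact ⟨h1, h2⟩
  · rw [fold_right hh ⟨h2, ht.2⟩]; constructor <;> linarith [ht.2]

/-- Reflection through an endpoint of the graph preserves the slope, so the derivative of the
extension is `φ'` composed with the folding, and the slopes match at `-h` and `0`. The derivatives
within the three closed pieces are glued; a piece not containing `t` contributes nothing. -/
theorem hasDerivAt_oddExt (hh : 0 < h) (φ : C1 h ℝ) {t : ℝ} (ht : t ∈ Ioo (-2 * h) h) :
    HasDerivAt (oddExt (incl φ)) (ev (der φ) (fold h t)) t := by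
  have hφ : ∀ s ∈ K h, HasDerivWithinAt (ev (incl φ)) (ev (der φ) s) (K h) s := φ.2
  have reflect (c s : ℝ) (A : Set ℝ) (hA : MapsTo (fun x => -x + c) A (K h)) (hs : s ∈ A) :
      HasDerivWithinAt (fun x => ev (incl φ) (-x + c)) (-ev (der φ) (-s + c)) A s := by
    have h1 : HasDerivWithinAt (fun x : ℝ => -x + c) (-1) A s :=
      ((hasDerivAt_id s).neg.add_const c).hasDerivWithinAt
    have := (hφ _ (hA hs)).scomp s h1 hA
    rw [neg_one_smul] at this
    exact this
  have h1 : HasDerivWithinAt (oddExt (incl φ)) (ev (der φ) (fold h t)) (Icc (-2 * h) (-h)) t := by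
    by_cases hs : t ∈ Icc (-2 * h) (-h)
    · have := (reflect (-2 * h) t (Icc (-2 * h) (-h))
        (fun _ hx => by constructor <;> linarith [hx.1, hx.2]) hs).const_sub (2 * ev (incl φ) (-h))
      rw [fold_left hs]
      rw [neg_neg] at this
      rw [show -t - 2 * h = -t + -2 * h by ring]
      refine this.congr_of_mem (fun x hx => ?_) hs
      unfold oddExt
      rcases hx.2.lt_or_eq with hlt | rfl
      · rw [if_pos hlt]; congr 2; ring
      · rw [if_neg (lt_irrefl _), if_pos (by linarith)]
        rw [show - -h + -2 * h = -h by ring]; ring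
    · exact HasFDerivWithinAt.of_notMem_closure (by rwa [isClosed_Icc.closure_eq])
  have h2 : HasDerivWithinAt (oddExt (incl φ)) (ev (der φ) (fold h t)) (Icc (-h) 0) t := by
    by_cases hs : t ∈ Icc (-h) 0
    · rw [fold_mid hs]
      refine (hφ t hs).congr_of_mem (fun x hx => ?_) hs
      unfold oddExt
      rw [if_neg (not_lt.2 hx.1), if_pos hx.2]
    · exact HasFDerivWithinAt.of_notMem_closure (by rwa [isClosed_Icc.closure_eq])
  have h3 : HasDerivWithinAt (oddExt (incl φ)) (ev (der φ) (fold h t)) (Icc 0 h) t := by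
    by_cases hs : t ∈ Icc 0 h
    · have := (reflect 0 t (Icc 0 h)
        (fun _ hx => by constructor <;> linarith [hx.1, hx.2]) hs).const_sub (2 * ev (incl φ) 0)
      rw [fold_right hh hs]
      rw [neg_neg] at this
      simp only [add_zero] at this
      refine this.congr_of_mem (fun x hx => ?_) hs
      unfold oddExt
      rw [if_neg (by linarith [hx.1])]
      rcases hx.1.lt_or_eq with hlt | rfl
      · rw [if_neg (not_le.2 hlt)]
      · rw [if_pos le_rfl, neg_zero]; ring
    · exact HasFDerivWithinAt.of_notMem_closure (by rwa [isClosed_Icc.closure_eq])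
  refine ((h1.union h2).union h3).hasDerivAt ?_
  rw [Icc_union_Icc_eq_Icc (by linarith) (by linarith),
    Icc_union_Icc_eq_Icc (by linarith) (by linarith)]
  exact Icc_mem_nhds ht.1 ht.2

/-- The Lipschitz constant is the `C¹` norm. It makes evaluation at `t` depend on `t` continuously
in the operator norm over `C¹`, and makes the mixed increment in `contDiffOn_oddExt` quadratic. -/
theorem abs_oddExt_sub_le (hh : 0 < h) (φ : C1 h ℝ) {s t : ℝ} (hs : s ∈ Ioo (-2 * h) h)
    (ht : t ∈ Ioo (-2 * h) h) :
    |oddExt (incl φ) t - oddExt (incl φ) s| ≤ ‖φ‖ * |t - s| :=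
  Convex.norm_image_sub_le_of_norm_hasDerivWithin_le
    (fun _ hx => (hasDerivAt_oddExt hh φ hx).hasDerivWithinAt)
    (fun _ _ => (norm_ev_le _ _).trans (norm_der_le φ)) (convex_Ioo _ _) hs ht

theorem continuousOn_oddL (hh : 0 < h) :
    ContinuousOn (fun t => (oddL h t).comp (inclL h ℝ)) (Ioo (-2 * h) h) := by
  have : LipschitzOnWith 1 (fun t => (oddL h t).comp (inclL h ℝ)) (Ioo (-2 * h) h) := by
    refine LipschitzOnWith.of_dist_le_mul fun t ht s hs => ?_
    rw [dist_eq_norm]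
    refine ContinuousLinearMap.opNorm_le_bound _ (by positivity) fun φ => ?_
    have := abs_oddExt_sub_le hh φ hs ht
    rw [mul_comm, ← Real.dist_eq, ← Real.norm_eq_abs] at this
    rw [NNReal.coe_one, one_mul]
    refine le_trans (le_of_eq ?_) this
    rw [← oddL_apply, ← oddL_apply]
    rfl
  exact this.continuousOn

theorem contDiffOn_oddExt (hh : 0 < h) :
    ContDiffOn ℝ 1 (fun p : C1 h ℝ × ℝ => oddExt (incl p.1) p.2) (univ ×ˢ Ioo (-2 * h) h) := by
  let D : C1 h ℝ × ℝ → (C1 h ℝ × ℝ →L[ℝ] ℝ) := fun p =>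
    ((oddL h p.2).comp (inclL h ℝ)).comp (ContinuousLinearMap.fst ℝ _ _) +
      ev (der p.1) (fold h p.2) • ContinuousLinearMap.snd ℝ (C1 h ℝ) ℝ
  refine contDiffOn_one_of_hasFDerivAt (f' := D) (isOpen_univ.prod isOpen_Ioo) ?_ ?_
  · rintro p₀ ⟨-, hp₀⟩
    rw [hasFDerivAt_iff_isLittleO]
    -- The remainder splits into the increment in `t` of the extension of `p.1 - p₀.1`, which is
    -- quadratic, and the one-variable remainder of the fixed function `p₀.1`.
    have e1 : (fun p : C1 h ℝ × ℝ => oddExt (incl (p.1 - p₀.1)) p.2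
        - oddExt (incl (p.1 - p₀.1)) p₀.2) =o[𝓝 p₀] fun p => p - p₀ := by
      refine Asymptotics.IsBigO.trans_isLittleO (g := fun p => ‖p - p₀‖ ^ 2) ?_
        (Asymptotics.isLittleO_pow_sub_sub p₀ one_lt_two)
      refine Asymptotics.IsBigO.of_bound 1 ?_
      have : ∀ᶠ p : C1 h ℝ × ℝ in 𝓝 p₀, p.2 ∈ Ioo (-2 * h) h :=
        continuous_snd.continuousAt.eventually (isOpen_Ioo.mem_nhds hp₀)
      filter_upwards [this] with p hp
      rw [Real.norm_eq_abs, one_mul, norm_pow, norm_norm, sq]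
      refine (abs_oddExt_sub_le hh _ hp₀ hp).trans ?_
      exact mul_le_mul (norm_fst_le (p - p₀)) (norm_snd_le (p - p₀)) (abs_nonneg _) (norm_nonneg _)
    have e2 : (fun p : C1 h ℝ × ℝ => oddExt (incl p₀.1) p.2 - oddExt (incl p₀.1) p₀.2
        - (p.2 - p₀.2) * ev (der p₀.1) (fold h p₀.2)) =o[𝓝 p₀] fun p => p - p₀ := by
      have := (hasDerivAt_iff_isLittleO.1 (hasDerivAt_oddExt hh p₀.1 hp₀)).comp_tendsto
        (continuous_snd.continuousAt (x := p₀))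
      refine this.trans_isBigO ?_
      exact Asymptotics.IsBigO.of_bound 1 (Eventually.of_forall fun p => by
        simpa using norm_snd_le (p - p₀))
    refine (e1.add e2).congr_left fun p => ?_
    have a (t : ℝ) : oddExt (incl (p.1 - p₀.1)) t
        = oddExt (incl p.1) t - oddExt (incl p₀.1) t := by
      rw [← oddL_apply, ← oddL_apply, ← oddL_apply, ← map_sub]; rfl
    simp only [D, add_apply, ContinuousLinearMap.comp_apply, inclL_apply,
      oddL_apply, smul_apply, ContinuousLinearMap.coe_fst',
      ContinuousLinearMap.coe_snd', Prod.fst_sub, Prod.snd_sub, a, smul_eq_mul]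
    ring
  · have c1 := continuousOn_oddL hh
    have c2 : ContinuousOn (fun p : C1 h ℝ × ℝ => ev (der p.1) (fold h p.2))
        (univ ×ˢ Ioo (-2 * h) h) := by
      have : Continuous fun p : C1 h ℝ × ℝ =>
          (derL h ℝ p.1) (projIcc (-h) 0 (by linarith) (fold h p.2)) := by
        refine Continuous.eval ((derL h ℝ).continuous.comp continuous_fst) ?_
        exact continuous_projIcc.comp ((continuous_fold h).comp continuous_snd)
      refine this.continuousOn.congr fun p hp => ?_
      have hm := fold_mem hh (Ioo_subset_Icc_self hp.2)
      rw [ev_of_mem _ hm]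
      show _ = (der p.1) (projIcc (-h) 0 _ (fold h p.2))
      rw [projIcc_of_mem _ hm]
    have c3 : ContinuousOn (fun p : C1 h ℝ × ℝ => (oddL h p.2).comp (inclL h ℝ))
        (univ ×ˢ Ioo (-2 * h) h) := c1.comp continuousOn_snd fun p hp => hp.2
    have c4 := c3.clm_comp
      (continuousOn_const (c := ContinuousLinearMap.fst ℝ (C1 h ℝ) ℝ))
    have c5 := c2.smul (continuousOn_const (c := ContinuousLinearMap.snd ℝ (C1 h ℝ) ℝ))
    exact c4.add c5

end OddExtension

/-! ### Components and the delayed vector -/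

section Components

variable {h : ℝ} {n k : ℕ}

/-- Taking the `j`-th component, `C¹_n → C¹`. -/
def comp1 (φ : C1 h (Rn n)) (j : Fin n) : C1 h ℝ :=
  ⟨WithLp.toLp 1 (comp (incl φ) j, comp (der φ) j), by
    intro t ht
    have := ((EuclideanSpace.proj (𝕜 := ℝ) j).hasFDerivAt).comp_hasDerivWithinAt t (φ.2 t ht)
    have e (f : C0 h (Rn n)) : ev (comp f j) = fun s => (ev f s) j := by
      funext s
      by_cases hs : s ∈ K h <;> simp [ev, hs, comp]
    show HasDerivWithinAt (ev (comp (incl φ) j)) (ev (comp (der φ) j) t) (K h) t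
    rw [e, e]
    exact this⟩

theorem norm_comp_le (f : C0 h (Rn n)) (j : Fin n) : ‖comp f j‖ ≤ ‖f‖ :=
  (ContinuousMap.norm_le _ (norm_nonneg _)).2 fun t =>
    (PiLp.norm_apply_le (f t) j).trans (f.norm_coe_le_norm t)

/-- Taking the `j`-th component as a continuous linear map `C¹_n → C¹`. -/
def comp1L (h : ℝ) (j : Fin n) : C1 h (Rn n) →L[ℝ] C1 h ℝ :=
  LinearMap.mkContinuous
    { toFun := fun φ => comp1 φ j
      map_add' := fun _ _ => rfl
      map_smul' := fun _ _ => rfl } 1 fun φ => by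
    have : ‖comp1 φ j‖ ≤ ‖φ‖ := by
      rw [norm_eq_incl_add_der, norm_eq_incl_add_der]
      exact add_le_add (norm_comp_le _ _) (norm_comp_le _ _)
    exact this.trans_eq (one_mul _).symm

theorem norm_vec_le (f : Fin n → C0 h ℝ) : ‖vec f‖ ≤ ∑ j, ‖f j‖ := by
  refine (ContinuousMap.norm_le _ (by positivity)).2 fun t => ?_
  have : vec f t = ∑ j, EuclideanSpace.single j (f j t) := by
    ext i; simp [vec, Finset.sum_apply, Pi.single_apply]
  rw [this]
  refine (norm_sum_le _ _).trans (Finset.sum_le_sum fun j _ => ?_)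
  rw [PiLp.norm_single]
  exact (f j).norm_coe_le_norm t

/-- Assembling components as a continuous linear map. -/
def vec1L (h : ℝ) (n : ℕ) : (Fin n → C1 h ℝ) →L[ℝ] C1 h (Rn n) :=
  LinearMap.mkContinuous
    { toFun := vec1
      map_add' := fun _ _ => rfl
      map_smul' := fun _ _ => rfl } n fun f => by
    have : ‖vec1 f‖ ≤ ∑ j, ‖f j‖ := by
      rw [norm_eq_incl_add_der]
      simp only [norm_eq_incl_add_der (f _), Finset.sum_add_distrib]
      exact add_le_add (norm_vec_le fun j => incl (f j)) (norm_vec_le fun j => der (f j))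
    refine this.trans ((Finset.sum_le_sum fun j _ => norm_le_pi_norm f j).trans_eq ?_)
    rw [Finset.sum_const, Finset.card_fin, nsmul_eq_mul]

theorem hat_apply (r : Rn k) (φ : C0 h (Rn n)) (i : Fin k × Fin n) :
    hat r φ i = oddExt (comp φ i.2) (r i.1) := rfl

theorem hat_sub (r : Rn k) (φ ψ : C0 h (Rn n)) : hat r (φ - ψ) = hat r φ - hat r ψ := by
  ext i
  rw [PiLp.sub_apply, hat_apply, hat_apply, hat_apply, ← oddL_apply, ← oddL_apply, ← oddL_apply,
    ← map_sub]
  rfl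

theorem isOpen_cube {I : Set ℝ} (hI : IsOpen I) : IsOpen (cube k I) := by
  have : cube k I = ⋂ κ, (fun r : Rn k => r κ) ⁻¹' I := by ext; simp [cube]
  rw [this]
  exact isOpen_iInter_of_finite fun κ => hI.preimage (by fun_prop)

theorem isCompact_cube {J : Set ℝ} (hJ : IsCompact J) : IsCompact (cube k J) := by
  have := (isCompact_univ_pi fun _ : Fin k => hJ).image
    (PiLp.continuous_toLp 2 (fun _ : Fin k => ℝ))
  convert this using 1
  ext r
  constructor
  · exact fun hr => ⟨fun κ => r κ, fun κ _ => hr κ, rfl⟩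
  · rintro ⟨f, hf, rfl⟩ κ
    exact hf κ (mem_univ _)

theorem contDiffOn_hat (hh : 0 < h) :
    ContDiffOn ℝ 1 (fun p : Rn k × C1 h (Rn n) => hat p.1 (incl p.2))
      (cube k (Ioo (-2 * h) h) ×ˢ univ) := by
  rw [contDiffOn_euclidean]
  intro i
  have : ContDiff ℝ 1 fun p : Rn k × C1 h (Rn n) => (comp1L h i.2 p.2, p.1 i.1) := by
    fun_prop
  exact (contDiffOn_oddExt hh).comp this.contDiffOn fun p hp => ⟨mem_univ _, hp.1 i.1⟩

end Components

/-! ### Smooth minorants -/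

/-- A positive function on an open set that is locally bounded away from zero has a positive
`C¹` minorant whose derivative is bounded by the same function. -/
theorem exists_contDiff_minorant {E : Type*} [NormedAddCommGroup E] [NormedSpace ℝ E]
    [FiniteDimensional ℝ E] {V : Set E} (hV : IsOpen V) (H : E → ℝ)
    (hH : ∀ v ∈ V, ∃ m > 0, ∀ᶠ w in 𝓝 v, m ≤ H w) :
    ∃ s : E → ℝ, ContDiff ℝ 1 s ∧ ∀ v ∈ V, 0 < s v ∧ s v ≤ H v ∧ ‖fderiv ℝ s v‖ ≤ H v := by
  rcases eq_empty_or_nonempty V with rfl | hne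
  · exact ⟨0, contDiff_const, by simp⟩
  -- These constraints survive countable convex combinations, and the global bounds by `1` make such
  -- series converge in `C¹`. It remains to find countably many members with no common zero in `V`:
  -- small bumps exist at each point, and the Lindelöf property selects countably many supports.
  let ι := { f : E → ℝ // ContDiff ℝ 1 f ∧ (∀ x, 0 ≤ f x) ∧ (∀ x, f x ≤ 1) ∧
    (∀ x, ‖fderiv ℝ f x‖ ≤ 1) ∧ (∀ x ∈ V, f x ≤ H x) ∧ (∀ x ∈ V, ‖fderiv ℝ f x‖ ≤ H x) }
  have hpos : ∀ v ∈ V, 0 < H v := fun v hv => by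
    obtain ⟨m, hm, he⟩ := hH v hv
    exact hm.trans_le he.self_of_nhds
  have hloc : ∀ v ∈ V, ∃ f : ι, f.1 v ≠ 0 := by
    intro v hv
    obtain ⟨m, hm, he⟩ := hH v hv
    obtain ⟨f, hfs, hfc, hfd, hfr, hfv⟩ := exists_contDiff_tsupport_subset (n := 1) he
    have hf0 (x) : 0 ≤ f x := (hfr (mem_range_self x)).1
    have hf1 (x) : f x ≤ 1 := (hfr (mem_range_self x)).2
    obtain ⟨C, hC⟩ := (hfc.fderiv (𝕜 := ℝ)).exists_bound_of_continuous
      (hfd.continuous_fderiv (by simp))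
    have hC0 : 0 ≤ C := (norm_nonneg _).trans (hC v)
    let a : ℝ := min 1 m / (1 + C)
    have ha : 0 < a := by positivity
    have haC : a * (1 + C) = min 1 m := div_mul_cancel₀ _ (by positivity)
    have hfa (x) : fderiv ℝ (fun y => a * f y) x = a • fderiv ℝ f x :=
      fderiv_const_mul (hfd.differentiable (by simp) x) a
    have hna (x) : ‖fderiv ℝ (fun y => a * f y) x‖ = a * ‖fderiv ℝ f x‖ := by
      rw [hfa, norm_smul, Real.norm_of_nonneg ha.le]
    have b1 (x) : a * f x ≤ min 1 m := by
      rw [← haC]; exact mul_le_mul_of_nonneg_left (by linarith [hf1 x]) ha.le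
    have b2 (x) : a * ‖fderiv ℝ f x‖ ≤ min 1 m := by
      rw [← haC]; exact mul_le_mul_of_nonneg_left (by linarith [hC x]) ha.le
    refine ⟨⟨fun x => a * f x, contDiff_const.mul hfd, fun x => mul_nonneg ha.le (hf0 x),
      fun x => (b1 x).trans (min_le_left _ _), fun x => ?_, fun x hx => ?_, fun x hx => ?_⟩, ?_⟩
    · rw [hna]; exact (b2 x).trans (min_le_left _ _)
    · by_cases hxs : x ∈ tsupport f
      · exact (b1 x).trans ((min_le_right _ _).trans (hfs hxs))
      · show a * f x ≤ H x
        rw [image_eq_zero_of_notMem_tsupport hxs, mul_zero]; exact (hpos x hx).le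
    · rw [hna]
      by_cases hxs : x ∈ tsupport f
      · exact (b2 x).trans ((min_le_right _ _).trans (hfs hxs))
      · have : fderiv ℝ f x = 0 := by
          by_contra hc
          exact hxs (support_fderiv_subset ℝ hc)
        rw [this, norm_zero, mul_zero]; exact (hpos x hx).le
    · simp [hfv, ha.ne']
  obtain ⟨T, hTc, hT⟩ := TopologicalSpace.isOpen_iUnion_countable
    (fun f : ι => Function.support f.1) fun f => f.2.1.continuous.isOpen_support
  have hcov : ∀ v ∈ V, ∃ f ∈ T, (f : ι).1 v ≠ 0 := by
    intro v hv
    have : v ∈ ⋃ f : ι, Function.support f.1 := mem_iUnion.2 (hloc v hv)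
    rw [← hT] at this
    simpa using this
  have hTne : T.Nonempty := by
    obtain ⟨v, hv⟩ := hne
    obtain ⟨f, hf, -⟩ := hcov v hv
    exact ⟨f, hf⟩
  obtain ⟨f, rfl⟩ := hTc.exists_eq_range hTne
  -- The weights sum to exactly `1`, so the series inherits the bound `H` for its values and its
  -- derivative.
  let u : ℕ → ℝ := fun i => 1 / 2 / 2 ^ i
  have hu : HasSum u 1 := hasSum_geometric_two' 1
  have hu0 (i) : 0 < u i := by positivity
  let g : ℕ → E → ℝ := fun i x => u i * (f i).1 x
  have hgd (i) : ContDiff ℝ 1 (g i) := contDiff_const.mul (f i).2.1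
  have hg0 (i x) : 0 ≤ g i x := mul_nonneg (hu0 i).le ((f i).2.2.1 x)
  have hgu (i x) : g i x ≤ u i := mul_le_of_le_one_right (hu0 i).le ((f i).2.2.2.1 x)
  have hgf (i x) : ‖fderiv ℝ (g i) x‖ = u i * ‖fderiv ℝ (f i).1 x‖ := by
    rw [show fderiv ℝ (g i) x = u i • fderiv ℝ (f i).1 x from
      fderiv_const_mul ((f i).2.1.differentiable (by simp) x) _, norm_smul,
      Real.norm_of_nonneg (hu0 i).le]
  have hgfu (i x) : ‖fderiv ℝ (g i) x‖ ≤ u i := by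
    rw [hgf]; exact mul_le_of_le_one_right (hu0 i).le ((f i).2.2.2.2.1 x)
  have hgs (x) : Summable fun i => g i x :=
    Summable.of_nonneg_of_le (fun i => hg0 i x) (fun i => hgu i x) hu.summable
  refine ⟨fun x => ∑' i, g i x, ?_, fun v hv => ⟨?_, ?_, ?_⟩⟩
  · refine contDiff_tsum (N := 1) (v := fun _ => u) hgd (fun _ _ => hu.summable) ?_
    intro j i x hj
    have hj' : j ≤ 1 := by exact_mod_cast hj
    interval_cases j
    · rw [norm_iteratedFDeriv_zero, Real.norm_of_nonneg (hg0 i x)]; exact hgu i x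
    · rw [norm_iteratedFDeriv_one]; exact hgfu i x
  · obtain ⟨_, ⟨i, rfl⟩, hi⟩ := hcov v hv
    exact (hgs v).tsum_pos (fun j => hg0 j v) i
      (mul_pos (hu0 i) (lt_of_le_of_ne ((f i).2.2.1 v) (Ne.symm hi)))
  · have hb : HasSum (fun i => u i * H v) (1 * H v) := hu.mul_right _
    rw [one_mul] at hb
    exact hasSum_le (fun i => mul_le_mul_of_nonneg_left ((f i).2.2.2.2.2.1 v hv) (hu0 i).le)
      (hgs v).hasSum hb
  · have hb : HasSum (fun i => u i * H v) (1 * H v) := hu.mul_right _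
    rw [one_mul] at hb
    rw [fderiv_tsum hu.summable (fun i => (hgd i).differentiable (by simp)) hgfu (hgs v)]
    exact tsum_of_norm_bounded hb fun i => (hgf i v).trans_le
      (mul_le_mul_of_nonneg_left ((f i).2.2.2.2.2.2 v hv) (hu0 i).le)

/-! ### Small functions with slope one at zero -/

section ExponentialFamily

variable {h : ℝ}

/-- The element of `C¹([-h,0], ℝ)` given by a function with continuous derivative. -/
def ofFun (h : ℝ) (f f' : ℝ → ℝ) (hf : ∀ t, HasDerivAt f (f' t) t) (hf' : Continuous f') :
    C1 h ℝ :=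
  ⟨WithLp.toLp 1 (⟨fun t => f t, (continuous_iff_continuousAt.2 fun t =>
      (hf t).continuousAt).comp continuous_subtype_val⟩, ⟨fun t => f' t, by fun_prop⟩), by
    intro t ht
    have e : (ev (⟨fun t => f t, (continuous_iff_continuousAt.2 fun t =>
        (hf t).continuousAt).comp continuous_subtype_val⟩ : C0 h ℝ)) = (K h).indicator f := by
      funext s
      by_cases hs : s ∈ K h <;> simp [ev, hs]
    have e' : ev (⟨fun t => f' t, by fun_prop⟩ : C0 h ℝ) t = f' t := by simp [ev, ht]
    show HasDerivWithinAt (ev (⟨fun t => f t, _⟩ : C0 h ℝ))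
      (ev (⟨fun t => f' t, _⟩ : C0 h ℝ) t) (K h) t
    rw [e, e']
    exact (hf t).hasDerivWithinAt.congr_of_mem (fun s hs => by simp [hs]) ht⟩

/-- The function `t ↦ t exp(a t)`. -/
def expFam (h a : ℝ) : C1 h ℝ :=
  ofFun h (fun t => t * Real.exp (a * t)) (fun t => (1 + a * t) * Real.exp (a * t))
    (fun t => by
      have := (hasDerivAt_id t).mul (((hasDerivAt_id t).const_mul a).exp)
      refine this.congr_deriv ?_
      simp; ring)
    (by fun_prop)

/-- The function `t ↦ t² exp(a t)`. -/
def expFamDeriv (h a : ℝ) : C1 h ℝ :=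
  ofFun h (fun t => t ^ 2 * Real.exp (a * t)) (fun t => (2 * t + a * t ^ 2) * Real.exp (a * t))
    (fun t => by
      have := (hasDerivAt_pow 2 t).mul (((hasDerivAt_id t).const_mul a).exp)
      refine this.congr_deriv ?_
      simp; ring)
    (by fun_prop)

theorem hasDerivAt_C1 {φ : ℝ → C1 h ℝ} {φ' : C1 h ℝ} {a : ℝ}
    (h1 : HasDerivAt (fun x => incl (φ x)) (incl φ') a)
    (h2 : HasDerivAt (fun x => der (φ x)) (der φ') a) : HasDerivAt φ φ' a := by
  rw [hasDerivAt_iff_isLittleO] at h1 h2 ⊢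
  rw [← Asymptotics.isLittleO_norm_left] at h1 h2 ⊢
  refine (h1.add h2).congr_left fun x => ?_
  rw [norm_eq_incl_add_der]
  rfl

theorem continuous_C1 {X : Type*} [TopologicalSpace X] {φ : X → C1 h ℝ}
    (h1 : Continuous fun x => incl (φ x)) (h2 : Continuous fun x => der (φ x)) :
    Continuous φ := by
  rw [continuous_iff_continuousAt]
  intro x
  rw [ContinuousAt, tendsto_iff_norm_sub_tendsto_zero]
  have e1 := tendsto_iff_norm_sub_tendsto_zero.1 (h1.tendsto x)
  have e2 := tendsto_iff_norm_sub_tendsto_zero.1 (h2.tendsto x)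
  refine Tendsto.congr (fun y => ?_) (by simpa using e1.add e2)
  rw [norm_eq_incl_add_der]
  rfl

/-- The inclusion of `[-h,0]` in `ℝ`. -/
def idC (h : ℝ) : C0 h ℝ := ⟨fun t => t, continuous_subtype_val⟩

/-- Evaluation is a continuous algebra homomorphism. Thus the exponential families can be written
with the exponential of the Banach algebra `C`, and their differentiability in `a` follows in the
maximum norm from the product rule. -/
theorem exp_apply (f : C0 h ℝ) (t : K h) : NormedSpace.exp f t = Real.exp (f t) := by
  have := NormedSpace.map_exp (ContinuousMap.evalAlgHom ℝ ℝ t : C(K h, ℝ) →ₐ[ℝ] ℝ)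
    (by exact continuous_eval_const t) f
  rw [Real.exp_eq_exp_ℝ]
  exact this

theorem incl_expFam (a : ℝ) : incl (expFam h a) = NormedSpace.exp (a • idC h) * idC h := by
  ext t
  rw [ContinuousMap.mul_apply, exp_apply]
  exact mul_comm _ _

theorem der_expFam (a : ℝ) :
    der (expFam h a) = NormedSpace.exp (a • idC h) * (1 + a • idC h) := by
  ext t
  rw [ContinuousMap.mul_apply, exp_apply]
  exact mul_comm _ _

theorem incl_expFamDeriv (a : ℝ) :
    incl (expFamDeriv h a) = NormedSpace.exp (a • idC h) * (idC h * idC h) := by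
  ext t
  rw [ContinuousMap.mul_apply, exp_apply, ContinuousMap.mul_apply, ← sq]
  exact mul_comm _ _

theorem der_expFamDeriv (a : ℝ) :
    der (expFamDeriv h a)
      = NormedSpace.exp (a • idC h) * ((2 : ℝ) • idC h + a • (idC h * idC h)) := by
  ext t
  rw [ContinuousMap.mul_apply, exp_apply]
  show (2 * (t : ℝ) + a * (t : ℝ) ^ 2) * Real.exp (a * t)
    = Real.exp (a * t) * (2 * (t : ℝ) + a * (t * t))
  ring

theorem hasDerivAt_expFam (a : ℝ) : HasDerivAt (expFam h) (expFamDeriv h a) a := by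
  have he := hasDerivAt_exp_smul_const (𝕂 := ℝ) (idC h) a
  refine hasDerivAt_C1 ?_ ?_
  · simp only [incl_expFam, incl_expFamDeriv]
    refine (he.mul_const (idC h)).congr_deriv ?_
    ring
  · simp only [der_expFam, der_expFamDeriv]
    have h2 : HasDerivAt (fun x : ℝ => 1 + x • idC h) (idC h) a := by
      simpa using ((hasDerivAt_id a).smul_const (idC h)).const_add 1
    refine (he.mul h2).congr_deriv ?_
    rw [two_smul, ← smul_mul_assoc]
    ring

theorem contDiff_expFam : ContDiff ℝ 1 (expFam h) := by
  rw [contDiff_one_iff_deriv]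
  refine ⟨fun a => (hasDerivAt_expFam a).differentiableAt, ?_⟩
  rw [show deriv (expFam h) = expFamDeriv h from funext fun a => (hasDerivAt_expFam a).deriv]
  have he : Continuous fun a : ℝ => NormedSpace.exp (a • idC h) :=
    continuous_iff_continuousAt.2 fun a =>
      (hasDerivAt_exp_smul_const (𝕂 := ℝ) (idC h) a).continuousAt
  refine continuous_C1 ?_ ?_
  · simp only [incl_expFamDeriv]; fun_prop
  · simp only [der_expFamDeriv]; fun_prop

theorem ev_der_expFam_zero (hh : 0 < h) (a : ℝ) : ev (der (expFam h a)) 0 = 1 := by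
  rw [ev_of_mem _ (⟨by linarith, le_rfl⟩ : (0 : ℝ) ∈ K h)]
  show (1 + a * 0) * Real.exp (a * 0) = 1
  simp

/-- With `x = -a t ≥ 0` this is `x exp(-x) ≤ 1`; the bound for `expFamDeriv` is likewise `x² exp(-x)
≤ 2`. -/
theorem norm_incl_expFam_le {a : ℝ} (ha : 0 < a) : ‖incl (expFam h a)‖ ≤ 1 / a := by
  refine (ContinuousMap.norm_le _ (by positivity)).2 fun t => ?_
  show |(t : ℝ) * Real.exp (a * t)| ≤ 1 / a
  have ht : (t : ℝ) ≤ 0 := t.2.2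
  rw [abs_mul, abs_of_nonpos ht, abs_of_pos (Real.exp_pos _), le_div_iff₀ ha]
  have h1 : -(a * t) ≤ Real.exp (-(a * t)) := by linarith [Real.add_one_le_exp (-(a * t))]
  have h2 : Real.exp (-(a * t)) * Real.exp (a * t) = 1 := by rw [← Real.exp_add]; simp
  have := mul_le_mul_of_nonneg_right h1 (Real.exp_pos (a * t)).le
  rw [h2] at this
  linarith

theorem norm_incl_expFamDeriv_le {a : ℝ} (ha : 0 < a) :
    ‖incl (expFamDeriv h a)‖ ≤ 2 / a ^ 2 := by
  refine (ContinuousMap.norm_le _ (by positivity)).2 fun t => ?_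
  show |(t : ℝ) ^ 2 * Real.exp (a * t)| ≤ 2 / a ^ 2
  have ht : (t : ℝ) ≤ 0 := t.2.2
  have hat : 0 ≤ -(a * t) := by nlinarith
  rw [abs_of_nonneg (by positivity), le_div_iff₀ (by positivity)]
  have h1 : (-(a * t)) ^ 2 ≤ 2 * Real.exp (-(a * t)) := by
    have := Real.quadratic_le_exp_of_nonneg hat
    linarith
  have h2 : Real.exp (-(a * t)) * Real.exp (a * t) = 1 := by rw [← Real.exp_add]; simp
  have := mul_le_mul_of_nonneg_right h1 (Real.exp_pos (a * t)).le
  rw [mul_assoc, h2] at this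
  linarith

/-- The functions in `C¹` whose derivative vanishes at `0` are dense in `C`. -/
theorem dense_incl_der_zero (hh : 0 < h) :
    Dense (incl '' {φ : C1 h ℝ | ev (der φ) 0 = 0}) := by
  rw [Metric.dense_iff]
  intro f ε hε
  -- A Weierstrass polynomial has the wrong slope `c` at `0`. Subtracting `c t exp(a t)` removes it
  -- and costs at most `|c| / a ≤ ε / 2`.
  obtain ⟨p, hp⟩ := exists_polynomial_near_continuousMap (-h) 0 f (ε / 2) (by positivity)
  let P : C1 h ℝ := ofFun h (fun t => p.eval t) (fun t => p.derivative.eval t)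
    (fun t => p.hasDerivAt t) (by fun_prop)
  let c : ℝ := ev (der P) 0
  let a : ℝ := 2 * (|c| + 1) / ε
  have ha : 0 < a := by positivity
  refine ⟨incl (P - c • expFam h a), ?_, P - c • expFam h a, ?_, rfl⟩
  · rw [Metric.mem_ball, dist_eq_norm]
    have e1 : incl (P - c • expFam h a) - f
        = (p.toContinuousMapOn (Icc (-h) 0) - f) - c • incl (expFam h a) := by
      show incl P - c • incl (expFam h a) - f = _
      rw [show incl P = p.toContinuousMapOn (Icc (-h) 0) from rfl]
      abel
    rw [e1]
    refine (norm_sub_le _ _).trans_lt ?_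
    have : ‖c • incl (expFam h a)‖ ≤ ε / 2 := by
      rw [norm_smul, Real.norm_eq_abs]
      refine (mul_le_mul_of_nonneg_left (norm_incl_expFam_le ha) (abs_nonneg c)).trans ?_
      rw [mul_one_div, div_le_iff₀ ha]
      simp only [a]
      field_simp
      linarith
    linarith
  · show ev (der P - c • der (expFam h a)) 0 = 0
    rw [← evL_apply, map_sub, map_smul, evL_apply, evL_apply, ev_der_expFam_zero hh]
    simp [c]

end ExponentialFamily

/-! ### Correction into the kernels of `q(r,·)` -/

/-- A jointly continuous family of linear maps, indexed by a compact set, is uniformly bounded. -/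
theorem exists_uniform_bound {X E G : Type*} [TopologicalSpace X] [NormedAddCommGroup E]
    [NormedSpace ℝ E] [CompleteSpace E] [NormedAddCommGroup G] [NormedSpace ℝ G] {A : Set X}
    (hA : IsCompact A) {f : X → E → G} (hlin : ∀ r ∈ A, IsLinearMap ℝ (f r))
    (hc : ContinuousOn (fun p : X × E => f p.1 p.2) (A ×ˢ univ)) :
    ∃ C, 0 ≤ C ∧ ∀ r ∈ A, ∃ L : E →L[ℝ] G, ‖L‖ ≤ C ∧ ∀ x, L x = f r x := by
  have hcr (r : X) (hr : r ∈ A) : Continuous (f r) :=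
    hc.comp_continuous (f := fun x => (r, x)) (by fun_prop) fun x => ⟨hr, mem_univ _⟩
  let L : A → E →L[ℝ] G := fun r => ⟨(hlin r r.2).mk' (f r), hcr r r.2⟩
  obtain ⟨C, hC⟩ := banach_steinhaus (g := L) fun x => by
    have : ContinuousOn (fun r => f r x) A :=
      hc.comp (f := fun r => (r, x)) (by fun_prop) fun r hr => ⟨hr, mem_univ _⟩
    obtain ⟨C, hC⟩ := hA.exists_bound_of_continuousOn this
    exact ⟨C, fun r => hC r r.2⟩
  exact ⟨max C 0, le_max_right _ _, fun r hr => ⟨L ⟨r, hr⟩, (hC _).trans (le_max_left _ _),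
    fun x => rfl⟩⟩

theorem contDiffOn_det {X : Type*} [NormedAddCommGroup X] [NormedSpace ℝ X] {d : ℕ}
    {M : X → Matrix (Fin d) (Fin d) ℝ} {s : Set X}
    (hM : ∀ i j, ContDiffOn ℝ 1 (fun x => M x i j) s) :
    ContDiffOn ℝ 1 (fun x => (M x).det) s := by
  simp only [Matrix.det_apply]
  exact ContDiffOn.sum fun σ _ => (contDiffOn_prod fun i _ => hM _ _).const_smul _

theorem continuousOn_det {X : Type*} [TopologicalSpace X] {d : ℕ}
    {M : X → Matrix (Fin d) (Fin d) ℝ} {s : Set X}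
    (hM : ∀ i j, ContinuousOn (fun x => M x i j) s) :
    ContinuousOn (fun x => (M x).det) s :=
  (Continuous.matrix_det continuous_id).comp_continuousOn
    (continuousOn_pi.2 fun i => continuousOn_pi.2 fun j => hM i j)

section Corrector

variable {h : ℝ} {k : ℕ} {F : Type*} [NormedAddCommGroup F] [NormedSpace ℝ F]
  [FiniteDimensional ℝ F]

/-- Condition (Hq) in coordinates. -/
theorem Hq.exists_coordinates {J : Set ℝ} {q : Rn k → C0 h ℝ → F} (hq : Hq J q) :
    ∃ (d : ℕ) (L : F →L[ℝ] (Fin d → ℝ)) (β : Fin d → C0 h ℝ),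
      (∀ r ∈ cube k J, ∀ f, L (q r f) = 0 → q r f = 0) ∧
      ∀ r ∈ cube k J, (Matrix.of fun i m => L (q r (β m)) i).det ≠ 0 := by
  obtain ⟨Fq, hr, hβ⟩ := hq
  let e : Fq ≃ₗ[ℝ] (Fin (Module.finrank ℝ Fq) → ℝ) := (Module.finBasis ℝ Fq).equivFun
  -- Coordinates on `Fq` are extended to `F`. The extension is injective on `Fq`, which contains all
  -- values of `q`; if `Fq = 0` the matrix is empty with determinant `1`.
  obtain ⟨L₀, hL₀⟩ := LinearMap.exists_extend (p := Fq) e.toLinearMap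
  have hinj : ∀ x ∈ Fq, L₀ x = 0 → x = 0 := by
    intro x hx h0
    have h1 : L₀ x = e ⟨x, hx⟩ := LinearMap.congr_fun hL₀ ⟨x, hx⟩
    rw [h1, LinearEquiv.map_eq_zero_iff] at h0
    exact congrArg Subtype.val h0
  have hmem : ∀ r ∈ cube k J, ∀ f, q r f ∈ Fq := fun r hrJ f => by
    have : q r f ∈ range (q r) := mem_range_self f
    rwa [hr r hrJ] at this
  have hker : ∀ r ∈ cube k J, ∀ f, L₀.toContinuousLinearMap (q r f) = 0 → q r f = 0 :=
    fun r hrJ f => hinj _ (hmem r hrJ f)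
  rcases hβ with h0 | ⟨β, hβ⟩
  · refine ⟨_, L₀.toContinuousLinearMap, 0, hker, fun r _ => ?_⟩
    have : IsEmpty (Fin (Module.finrank ℝ Fq)) := by
      rw [h0, finrank_bot]; infer_instance
    rw [Matrix.det_isEmpty]
    exact one_ne_zero
  · refine ⟨_, L₀.toContinuousLinearMap, β, hker, fun r hrJ => ?_⟩
    obtain ⟨hli, hsp⟩ := hβ r hrJ
    have hdis : Disjoint (Submodule.span ℝ (range fun m => q r (β m))) (LinearMap.ker L₀) := by
      rw [hsp, Submodule.disjoint_def]
      exact fun x hx hx' => hinj x hx hx'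
    have hcol : LinearIndependent ℝ (Matrix.of fun i m => L₀ (q r (β m)) i).col := hli.map hdis
    rw [Matrix.linearIndependent_cols_iff_isUnit, Matrix.isUnit_iff_isUnit_det] at hcol
    exact hcol.ne_zero

/-- For `q` with property (Hq) there are linear maps `P r` of `C¹` into the kernels of `q(r,·)` that
change neither the derivative at `0` nor the order of magnitude of the maximum norm. -/
theorem Hq.exists_corrector (hh : 0 < h) {I J : Set ℝ} (hJ : IsCompact J) (hIJ : I ⊆ J)
    {q : Rn k → C0 h ℝ → F} (hq : Hq J q) (hlin : ∀ r ∈ cube k J, IsLinearMap ℝ (q r))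
    (hc : ContinuousOn (fun p : Rn k × C0 h ℝ => q p.1 p.2) (cube k J ×ˢ univ))
    (hd : ContDiffOn ℝ 1 (fun p : Rn k × C1 h ℝ => q p.1 (incl p.2)) (cube k I ×ˢ univ)) :
    ∃ P : Rn k → C1 h ℝ → C1 h ℝ,
      ContDiffOn ℝ 1 (fun p : Rn k × C1 h ℝ => P p.1 p.2) (cube k I ×ˢ univ) ∧
      (∀ r ∈ cube k I, ∀ φ, q r (incl (P r φ)) = 0) ∧
      (∀ r φ, ev (der (P r φ)) 0 = ev (der φ) 0) ∧
      ∃ C, 0 ≤ C ∧ ∀ r ∈ cube k I, ∃ L : C0 h ℝ →L[ℝ] C0 h ℝ, ‖L‖ ≤ C ∧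
        ∀ φ, incl (P r φ) = L (incl φ) := by
  have hJk : IsCompact (cube k J) := isCompact_cube hJ
  have hsub : cube k I ⊆ cube k J := fun r hr κ => hIJ (hr κ)
  obtain ⟨d, L, β, hker, hdet⟩ := hq.exists_coordinates
  -- By compactness of `J^k`, the determinants stay nonzero for all `r` at once under small changes
  -- of the `β_m`. So the `β_m` may be replaced by `C¹` functions with zero slope at `0`, which are
  -- dense in `C`.
  have hev : ∀ᶠ β' in 𝓝 β, ∀ r ∈ (univ : Set (cube k J)),
      (Matrix.of fun i m => L (q r (β' m)) i).det ≠ 0 := by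
    refine (isCompact_iff_isCompact_univ.1 hJk).eventually_forall_of_forall_eventually
      fun r _ => ?_
    have hcont : Continuous fun z : (Fin d → C0 h ℝ) × cube k J =>
        (Matrix.of fun i m => L (q z.2 (z.1 m)) i).det := by
      refine Continuous.matrix_det (continuous_pi fun i => continuous_pi fun m => ?_)
      have : Continuous fun z : (Fin d → C0 h ℝ) × cube k J => q z.2 (z.1 m) :=
        hc.comp_continuous (f := fun z : (Fin d → C0 h ℝ) × cube k J => ((z.2 : Rn k), z.1 m))
          (by fun_prop) fun z => ⟨z.2.2, mem_univ _⟩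
      exact (continuous_apply i).comp (L.continuous.comp this)
    exact hcont.continuousAt.eventually_ne (hdet r r.2)
  obtain ⟨β', hβ', hβD⟩ := (dense_pi (univ : Set (Fin d)) fun _ _ =>
    dense_incl_der_zero hh).inter_nhds_nonempty hev
  choose b hb0 hbβ using fun m => hβ' m (mem_univ m)
  let A : Rn k → Matrix (Fin d) (Fin d) ℝ := fun r => Matrix.of fun i m => L (q r (incl (b m))) i
  have hA : ∀ r ∈ cube k J, (A r).det ≠ 0 := fun r hr => by
    have := hβD ⟨r, hr⟩ (mem_univ _)
    simpa only [A, hbβ] using this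
  -- Cramer's rule solves `A r · c = L (q r f)` by a quotient of determinants, so the coefficients
  -- inherit continuity on `J^k × C` and smoothness on `I^k × C¹` from `q`.
  let c : Rn k → C0 h ℝ → Fin d → ℝ := fun r f m => (A r).cramer (L (q r f)) m / (A r).det
  have hAc : ∀ r ∈ cube k J, ∀ f, (A r).mulVec (c r f) = L (q r f) := fun r hr f => by
    have : c r f = (A r).det⁻¹ • (A r).cramer (L (q r f)) := by
      funext m; simp [c, div_eq_inv_mul]
    rw [this, Matrix.mulVec_smul, Matrix.mulVec_cramer, inv_smul_smul₀ (hA r hr)]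
  have hclin : ∀ r ∈ cube k J, ∀ m, IsLinearMap ℝ fun f => c r f m := fun r hr m =>
    { map_add := fun f g => by
        simp only [c]
        rw [(hlin r hr).map_add, map_add, map_add, Pi.add_apply, add_div]
      map_smul := fun a f => by
        simp only [c]
        rw [(hlin r hr).map_smul, map_smul, map_smul, Pi.smul_apply, smul_div_assoc] }
  have hcc : ∀ m, ContinuousOn (fun p : Rn k × C0 h ℝ => c p.1 p.2 m) (cube k J ×ˢ univ) := by
    intro m
    have hAe : ∀ i j, ContinuousOn (fun p : Rn k × C0 h ℝ => A p.1 i j) (cube k J ×ˢ univ) := by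
      intro i j
      have : ContinuousOn (fun p : Rn k × C0 h ℝ => q p.1 (incl (b j))) (cube k J ×ˢ univ) :=
        hc.comp (f := fun p : Rn k × C0 h ℝ => (p.1, incl (b j))) (by fun_prop)
          fun p hp => ⟨hp.1, mem_univ _⟩
      exact (continuous_apply i).comp_continuousOn (L.continuous.comp_continuousOn this)
    have hqe : ∀ i, ContinuousOn (fun p : Rn k × C0 h ℝ => L (q p.1 p.2) i)
        (cube k J ×ˢ univ) := fun i =>
      (continuous_apply i).comp_continuousOn (L.continuous.comp_continuousOn hc)
    refine ContinuousOn.div ?_ (continuousOn_det hAe) fun p hp => hA _ hp.1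
    simp only [Matrix.cramer_apply]
    refine continuousOn_det fun i j => ?_
    simp only [Matrix.updateCol_apply]
    split_ifs
    exacts [hqe i, hAe i j]
  have hcd : ∀ m, ContDiffOn ℝ 1 (fun p : Rn k × C1 h ℝ => c p.1 (incl p.2) m)
      (cube k I ×ˢ univ) := by
    intro m
    have hAe : ∀ i j, ContDiffOn ℝ 1 (fun p : Rn k × C1 h ℝ => A p.1 i j) (cube k I ×ˢ univ) := by
      intro i j
      have : ContDiffOn ℝ 1 (fun p : Rn k × C1 h ℝ => q p.1 (incl (b j))) (cube k I ×ˢ univ) :=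
        hd.comp (f := fun p : Rn k × C1 h ℝ => (p.1, b j))
          (contDiff_fst.prodMk contDiff_const).contDiffOn fun p hp => ⟨hp.1, mem_univ _⟩
      exact contDiffOn_pi.1 (L.contDiff.comp_contDiffOn this) i
    have hqe : ∀ i, ContDiffOn ℝ 1 (fun p : Rn k × C1 h ℝ => L (q p.1 (incl p.2)) i)
        (cube k I ×ˢ univ) := contDiffOn_pi.1 (L.contDiff.comp_contDiffOn hd)
    refine ContDiffOn.div ?_ (contDiffOn_det hAe) fun p hp => hA _ (hsub hp.1)
    simp only [Matrix.cramer_apply]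
    refine contDiffOn_det fun i j => ?_
    simp only [Matrix.updateCol_apply]
    split_ifs
    exacts [hqe i, hAe i j]
  -- The same corrector on `C`: its continuity over the compact `J^k` gives the uniform bound in the
  -- maximum norm, while `P` on `C¹` carries the smoothness.
  let P₀ : Rn k → C0 h ℝ → C0 h ℝ := fun r f => f - ∑ m, c r f m • incl (b m)
  let P : Rn k → C1 h ℝ → C1 h ℝ := fun r φ => φ - ∑ m, c r (incl φ) m • b m
  have hPP : ∀ r φ, incl (P r φ) = P₀ r (incl φ) := fun r φ => by
    rw [← inclL_apply]
    simp only [P, P₀, map_sub, map_sum, map_smul, inclL_apply]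
  have hP₀lin : ∀ r ∈ cube k J, IsLinearMap ℝ (P₀ r) := fun r hr =>
    { map_add := fun f g => by
        simp only [P₀, fun m => (hclin r hr m).map_add, add_smul, Finset.sum_add_distrib]
        abel
      map_smul := fun a f => by
        simp only [P₀, fun m => (hclin r hr m).map_smul, smul_assoc, ← Finset.smul_sum, smul_sub] }
  refine ⟨P, ?_, fun r hr φ => ?_, fun r φ => ?_, ?_⟩
  · exact contDiffOn_snd.sub (ContDiffOn.sum fun m _ => (hcd m).smul contDiffOn_const)
  · apply hker r (hsub hr)
    have hl := hlin r (hsub hr)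
    have : q r (P₀ r (incl φ))
        = q r (incl φ) - ∑ m, c r (incl φ) m • q r (incl (b m)) := by
      have h1 := map_sub (hl.mk' _) (incl φ) (∑ m, c r (incl φ) m • incl (b m))
      simp only [map_sum, map_smul, IsLinearMap.mk'_apply] at h1
      exact h1
    rw [hPP, this, map_sub, map_sum, sub_eq_zero, ← hAc r (hsub hr) (incl φ)]
    funext i
    simp [Matrix.mulVec, dotProduct, A, mul_comm]
  · show evL h ℝ 0 (derL h ℝ (P r φ)) = _
    simp only [P, map_sub, map_sum, map_smul, derL_apply, evL_apply]
    have : ∀ m, ev (der (b m)) 0 = 0 := hb0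
    simp [this]
  · obtain ⟨C, hC0, hC⟩ := exists_uniform_bound hJk hP₀lin (continuousOn_snd.sub
      (continuousOn_finsetSum _ fun m _ => (hcc m).smul continuousOn_const))
    refine ⟨C, hC0, fun r hr => ?_⟩
    obtain ⟨Lr, h1, h2⟩ := hC r (hsub hr)
    exact ⟨Lr, h1, fun φ => by rw [hPP, h2]⟩

end Corrector

section SingleComponent

variable {h : ℝ} {n : ℕ}

/-- Assembling components as a continuous linear map between spaces of continuous functions. -/
def vecL (h : ℝ) (n : ℕ) : (Fin n → C0 h ℝ) →L[ℝ] C0 h (Rn n) :=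
  LinearMap.mkContinuous
    { toFun := vec
      map_add' := fun _ _ => rfl
      map_smul' := fun _ _ => rfl } n fun f => by
    have : ‖vec f‖ ≤ ∑ j, ‖f j‖ := norm_vec_le f
    refine this.trans ((Finset.sum_le_sum fun j _ => norm_le_pi_norm f j).trans_eq ?_)
    rw [Finset.sum_const, Finset.card_fin, nsmul_eq_mul]

theorem incl_vec1 (f : Fin n → C1 h ℝ) : incl (vec1 f) = vec fun j => incl (f j) := rfl

theorem incl_vec1_single (j : Fin n) (φ : C1 h ℝ) :
    incl (vec1 (Pi.single j φ)) = vec (Pi.single j (incl φ)) := by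
  rw [incl_vec1]
  congr 1
  funext i
  exact Pi.apply_single (fun _ => inclL h ℝ) (fun _ => map_zero _) j φ i

end SingleComponent

/-! ### The function `h_g` and the existence of admissible maps -/

namespace System

variable {h : ℝ} {n k : ℕ} {F : Type*} [NormedAddCommGroup F] [NormedSpace ℝ F]
  (S : System h n k F)

theorem isOpen_Ik : IsOpen S.Ik := isOpen_cube isOpen_Ioo

theorem Ik_subset : S.Ik ⊆ cube k (Icc S.c S.d) := fun _ hr κ => S.I_subset_J (hr κ)

/-- An open subset of `[-2h,h]` lies in its interior, which is where the odd extension is known to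
be differentiable. -/
theorem I_subset (S : System h n k F) : Ioo S.a S.b ⊆ Ioo (-2 * h) h := by
  have := interior_mono (S.I_subset_J.trans S.J_subset)
  rwa [interior_Icc, isOpen_Ioo.interior_eq] at this

theorem Ik_subset_cube : S.Ik ⊆ cube k (Ioo (-2 * h) h) := fun _ hr κ => S.I_subset (hr κ)

/-- The numerator of `h_g`. -/
def margin (v : Rkn k n) : ℝ :=
  open Classical in if S.V = univ then 1 else min 1 (Metric.infDist v S.Vᶜ)

theorem margin_pos {v : Rkn k n} (hv : v ∈ S.V) : 0 < S.margin v := by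
  unfold margin
  split_ifs with hV
  · exact one_pos
  · refine lt_min one_pos ?_
    rw [← S.isOpen_V.isClosed_compl.notMem_iff_infDist_pos (nonempty_compl.2 hV)]
    simpa using hv

theorem margin_le_one (v : Rkn k n) : S.margin v ≤ 1 := by
  unfold margin
  split_ifs
  · exact le_rfl
  · exact min_le_left _ _

theorem continuous_margin : Continuous S.margin := by
  unfold margin
  split_ifs
  · exact continuous_const
  · exact continuous_const.min (Metric.continuous_infDist_pt _)

theorem ball_margin_subset (v : Rkn k n) : Metric.ball v (S.margin v) ⊆ S.V := by
  unfold margin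
  split_ifs with hV
  · rw [hV]; exact subset_univ _
  · refine (Metric.ball_subset_ball (min_le_right _ _)).trans ?_
    intro w hw
    by_contra hwV
    rw [Metric.mem_ball'] at hw
    exact absurd (Metric.infDist_le_dist_of_mem (show w ∈ S.Vᶜ from hwV)) (not_le.2 hw)

theorem abs_fderiv_g_le_iSup (v : Rkn k n) (i : Fin k × Fin n) (j : Fin n) :
    |fderiv ℝ S.g v (EuclideanSpace.single i 1) j| ≤
      ⨆ i : (Fin k × Fin n) × Fin n, |fderiv ℝ S.g v (EuclideanSpace.single i.1 1) i.2| :=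
  le_ciSup (f := fun i : (Fin k × Fin n) × Fin n =>
    |fderiv ℝ S.g v (EuclideanSpace.single i.1 1) i.2|) (finite_range _).bddAbove (i, j)

theorem abs_g_le_iSup (v : Rkn k n) (j : Fin n) : |S.g v j| ≤ ⨆ j : Fin n, |S.g v j| :=
  le_ciSup (f := fun j : Fin n => |S.g v j|) (finite_range _).bddAbove j

theorem hg_locally_bounded_below (hn : 0 < n) (hk : 0 < k) {v : Rkn k n} (hv : v ∈ S.V) :
    ∃ m > 0, ∀ᶠ w in 𝓝 v, m ≤ S.hg w := by
  have : Nonempty (Fin n) := ⟨⟨0, hn⟩⟩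
  have : Nonempty (Fin k) := ⟨⟨0, hk⟩⟩
  have hn' : (0 : ℝ) < n := by exact_mod_cast hn
  have hk' : (0 : ℝ) < k := by exact_mod_cast hk
  have hm := S.margin_pos hv
  have e1 : ∀ᶠ w in 𝓝 v, S.margin v / 2 < S.margin w :=
    S.continuous_margin.continuousAt.eventually (lt_mem_nhds (by linarith))
  have e2 : ∀ᶠ w in 𝓝 v, ‖fderiv ℝ S.g w‖ < ‖fderiv ℝ S.g v‖ + 1 :=
    ((S.contDiffOn_g.continuousOn_fderiv_of_isOpen S.isOpen_V le_rfl).continuousAt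
      (S.isOpen_V.mem_nhds hv)).norm.eventually (gt_mem_nhds (by linarith))
  have e3 : ∀ᶠ w in 𝓝 v, ‖S.g w‖ < ‖S.g v‖ + 1 :=
    (S.contDiffOn_g.continuousOn.continuousAt
      (S.isOpen_V.mem_nhds hv)).norm.eventually (gt_mem_nhds (by linarith))
  refine ⟨S.margin v / 2 / (6 * k * n * (1 + (‖fderiv ℝ S.g v‖ + 1) + (‖S.g v‖ + 1))),
    by positivity, ?_⟩
  filter_upwards [e1, e2, e3] with w h1 h2 h3
  have b1 : (⨆ i : (Fin k × Fin n) × Fin n, |fderiv ℝ S.g w (EuclideanSpace.single i.1 1) i.2|)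
      ≤ ‖fderiv ℝ S.g v‖ + 1 := by
    refine ciSup_le fun i => ?_
    refine (PiLp.norm_apply_le _ _).trans (((fderiv ℝ S.g w).le_opNorm _).trans ?_)
    rw [PiLp.norm_single, norm_one, mul_one]
    exact h2.le
  have b2 : (⨆ j : Fin n, |S.g w j|) ≤ ‖S.g v‖ + 1 :=
    ciSup_le fun j => (PiLp.norm_apply_le _ _).trans h3.le
  have b3 : 0 ≤ ⨆ i : (Fin k × Fin n) × Fin n,
      |fderiv ℝ S.g w (EuclideanSpace.single i.1 1) i.2| := Real.iSup_nonneg fun _ => abs_nonneg _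
  have b4 : 0 ≤ ⨆ j : Fin n, |S.g w j| := Real.iSup_nonneg fun _ => abs_nonneg _
  show _ ≤ S.margin w / _
  refine div_le_div₀ ((half_pos hm).trans h1).le h1.le (by positivity) ?_
  exact mul_le_mul_of_nonneg_left (by linarith) (by positivity)

/-- The data of an admissible family for one component. -/
theorem exists_admissible_component [FiniteDimensional ℝ F] (hh : 0 < h) (hn : 0 < n) (hk : 0 < k)
    (j : Fin n) :
    ∃ χ : Rn k × Rkn k n → C1 h ℝ, ContDiffOn ℝ 1 χ (S.Ik ×ˢ S.V) ∧
      ∀ r ∈ S.Ik, ∀ v ∈ S.V, S.Q (r, vec (Pi.single j (incl (χ (r, v))))) = 0 ∧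
        ev (der (χ (r, v))) 0 = 1 ∧ ‖incl (χ (r, v))‖ ≤ S.hg v ∧
        ∀ ν, ‖incl (fderiv ℝ (fun w => χ (r, w)) v (EuclideanSpace.single ν 1))‖ ≤ S.hg v := by
  let e0 : C0 h ℝ →L[ℝ] C0 h (Rn n) := (vecL h n).comp (ContinuousLinearMap.single ℝ (fun _ => C0 h ℝ) j)
  let e1 : C1 h ℝ →L[ℝ] C1 h (Rn n) := (vec1L h n).comp (ContinuousLinearMap.single ℝ (fun _ => C1 h ℝ) j)
  have hlin : ∀ r ∈ cube k (Icc S.c S.d),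
      IsLinearMap ℝ fun f : C0 h ℝ => S.Q (r, vec (Pi.single j f)) := fun r hr =>
    (((S.linear_Q r hr).mk' _).comp e0.toLinearMap).isLinear
  have hc : ContinuousOn (fun p : Rn k × C0 h ℝ => S.Q (p.1, vec (Pi.single j p.2)))
      (cube k (Icc S.c S.d) ×ˢ univ) :=
    S.continuousOn_Q.comp (f := fun p : Rn k × C0 h ℝ => (p.1, e0 p.2))
      (by fun_prop) fun p hp => ⟨hp.1, mem_univ _⟩
  have hd : ContDiffOn ℝ 1 (fun p : Rn k × C1 h ℝ => S.Q (p.1, vec (Pi.single j (incl p.2))))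
      (cube k (Ioo S.a S.b) ×ˢ univ) := by
    have h1 : ContDiff ℝ 1 fun p : Rn k × C1 h ℝ => (p.1, e1 p.2) :=
      contDiff_fst.prodMk (e1.contDiff.comp contDiff_snd)
    have := S.contDiffOn_Q.comp h1.contDiffOn
      (t := cube k (Ioo S.a S.b) ×ˢ univ) (s := cube k (Ioo S.a S.b) ×ˢ univ)
      fun p hp => ⟨hp.1, mem_univ _⟩
    refine this.congr fun p _ => ?_
    show _ = S.Q (p.1, incl (vec1 (Pi.single j p.2)))
    rw [incl_vec1_single]
  obtain ⟨P, hPd, hPQ, hPder, C, hC0, hPC⟩ :=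
    (S.hq j).exists_corrector hh isCompact_Icc S.I_subset_J hlin hc hd
  -- The corrected function has norm at most `C s`. Its partial derivatives are bounded by `(|Ds| /
  -- s²) · C · 2 s² = 2 C |Ds|`. The divisor `2 C + 1` covers both and is positive even for `C = 0`.
  obtain ⟨s, hs, hsV⟩ := exists_contDiff_minorant S.isOpen_V (fun v => S.hg v / (2 * C + 1))
    fun v hv => by
      obtain ⟨m, hm, he⟩ := S.hg_locally_bounded_below hn hk hv
      refine ⟨m / (2 * C + 1), by positivity, he.mono fun w hw => ?_⟩
      exact div_le_div_of_nonneg_right hw (by positivity)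
  let χ : Rn k × Rkn k n → C1 h ℝ := fun p => P p.1 (expFam h (s p.2)⁻¹)
  have hχ : ContDiffOn ℝ 1 χ (S.Ik ×ˢ S.V) := by
    have h1 : ContDiffOn ℝ 1 (fun p : Rn k × Rkn k n => (s p.2)⁻¹) (S.Ik ×ˢ S.V) :=
      (hs.comp contDiff_snd).contDiffOn.inv fun p hp => (hsV p.2 hp.2).1.ne'
    exact hPd.comp (contDiffOn_fst.prodMk (contDiff_expFam.comp_contDiffOn h1))
      fun p hp => ⟨hp.1, mem_univ _⟩
  refine ⟨χ, hχ, fun r hr v hv => ?_⟩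
  obtain ⟨hs0, hs1, hs2⟩ := hsV v hv
  have hhg : s v * (2 * C + 1) ≤ S.hg v := (le_div_iff₀ (by positivity)).1 hs1
  have hhg' : ‖fderiv ℝ s v‖ * (2 * C + 1) ≤ S.hg v := (le_div_iff₀ (by positivity)).1 hs2
  obtain ⟨L, hLC, hL⟩ := hPC r hr
  refine ⟨hPQ r hr _, ?_, ?_, fun ν => ?_⟩
  · rw [hPder, ev_der_expFam_zero hh]
  · rw [hL]
    refine (L.le_opNorm _).trans ((mul_le_mul hLC (norm_incl_expFam_le (inv_pos.2 hs0))
      (norm_nonneg _) hC0).trans ?_)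
    rw [one_div, inv_inv]
    nlinarith
  · have hdχ : DifferentiableAt ℝ (fun w => χ (r, w)) v := by
      have h1 : ContDiffOn ℝ 1 (fun w => χ (r, w)) S.V :=
        hχ.comp (contDiff_const.prodMk contDiff_id).contDiffOn fun w hw => ⟨hr, hw⟩
      exact (h1.differentiableOn (by simp)).differentiableAt (S.isOpen_V.mem_nhds hv)
    have d1 : HasFDerivAt (fun w => incl (χ (r, w)))
        ((inclL h ℝ).comp (fderiv ℝ (fun w => χ (r, w)) v)) v :=
      (inclL h ℝ).hasFDerivAt.comp v hdχ.hasFDerivAt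
    have d2 : HasFDerivAt (fun w => (s w)⁻¹) (-(s v ^ 2)⁻¹ • fderiv ℝ s v) v :=
      (hasDerivAt_inv hs0.ne').comp_hasFDerivAt v
        (hs.differentiable (by simp) v).hasFDerivAt
    have d3 : HasFDerivAt (fun w => expFam h (s w)⁻¹)
        ((-(s v ^ 2)⁻¹ • fderiv ℝ s v).smulRight (expFamDeriv h (s v)⁻¹)) v := by
      have := (hasDerivAt_expFam (h := h) (s v)⁻¹).hasFDerivAt.comp v d2
      refine this.congr_fderiv ?_
      ext1 x
      rw [ContinuousLinearMap.comp_apply, ContinuousLinearMap.smulRight_apply,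
        ContinuousLinearMap.toSpanSingleton_apply]
    have d4 : HasFDerivAt (fun w => incl (χ (r, w)))
        ((L.comp (inclL h ℝ)).comp
          ((-(s v ^ 2)⁻¹ • fderiv ℝ s v).smulRight (expFamDeriv h (s v)⁻¹))) v := by
      have := (L.comp (inclL h ℝ)).hasFDerivAt.comp v d3
      refine this.congr_of_eventuallyEq (Eventually.of_forall fun w => ?_)
      exact hL _
    have e := DFunLike.congr_fun (d1.unique d4) (EuclideanSpace.single ν 1)
    have e' : incl (fderiv ℝ (fun w => χ (r, w)) v (EuclideanSpace.single ν 1))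
        = (-(s v ^ 2)⁻¹ * fderiv ℝ s v (EuclideanSpace.single ν 1)) •
          L (incl (expFamDeriv h (s v)⁻¹)) := by
      refine e.trans ?_
      rw [ContinuousLinearMap.comp_apply, ContinuousLinearMap.smulRight_apply, map_smul]
      rfl
    rw [e', norm_smul, norm_mul, norm_neg, norm_inv, norm_pow, Real.norm_of_nonneg hs0.le]
    have b1 : ‖fderiv ℝ s v (EuclideanSpace.single ν 1)‖ ≤ ‖fderiv ℝ s v‖ := by
      refine ((fderiv ℝ s v).le_opNorm _).trans_eq ?_
      rw [PiLp.norm_single, norm_one, mul_one]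
    have b2 : ‖L (incl (expFamDeriv h (s v)⁻¹))‖ ≤ C * (2 * s v ^ 2) := by
      refine (L.le_opNorm _).trans (mul_le_mul hLC ((norm_incl_expFamDeriv_le
        (inv_pos.2 hs0)).trans_eq ?_) (norm_nonneg _) hC0)
      rw [inv_pow, div_inv_eq_mul]
    calc (s v ^ 2)⁻¹ * ‖fderiv ℝ s v (EuclideanSpace.single ν 1)‖
          * ‖L (incl (expFamDeriv h (s v)⁻¹))‖
        ≤ (s v ^ 2)⁻¹ * ‖fderiv ℝ s v‖ * (C * (2 * s v ^ 2)) := by gcongr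
      _ = ‖fderiv ℝ s v‖ * (2 * C) := by field_simp
      _ ≤ S.hg v := by linarith [norm_nonneg (fderiv ℝ s v)]

theorem exists_isAdmissible [FiniteDimensional ℝ F] (hh : 0 < h) (hn : 0 < n) (hk : 0 < k) :
    ∃ χ, S.IsAdmissible χ := by
  choose χ h1 h2 using S.exists_admissible_component hh hn hk
  exact ⟨χ, h1, fun j r hr v hv => (h2 j r hr v hv).1, fun j r hr v hv => (h2 j r hr v hv).2.1,
    fun j r hr v hv => (h2 j r hr v hv).2.2.1, fun j r hr v hv => (h2 j r hr v hv).2.2.2⟩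

end System

/-! ### Contraction estimate and global inverse function theorem -/

theorem euclidean_norm_le_sum_abs {ι : Type*} [Fintype ι] (x : EuclideanSpace ℝ ι) :
    ‖x‖ ≤ ∑ i, |x i| := by
  rw [EuclideanSpace.norm_eq]
  refine Real.sqrt_le_iff.2 ⟨Finset.sum_nonneg fun _ _ => abs_nonneg _, ?_⟩
  exact Finset.sum_sq_le_sq_sum_of_nonneg fun _ _ => abs_nonneg _

/-- A matrix with small entries is a contraction for the Euclidean norm. -/
theorem euclidean_norm_apply_le_half {ι : Type*} [Fintype ι] [DecidableEq ι]
    (A : EuclideanSpace ℝ ι →L[ℝ] EuclideanSpace ℝ ι)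
    (hA : ∀ ν i, |A (EuclideanSpace.single ν 1) i| ≤ 1 / (2 * Fintype.card ι))
    (w : EuclideanSpace ℝ ι) : ‖A w‖ ≤ 1 / 2 * ‖w‖ := by
  rcases isEmpty_or_nonempty ι with hι | hι
  · have h1 : A w = 0 := Subsingleton.elim _ _
    rw [h1, norm_zero]; positivity
  have hN : (0 : ℝ) < Fintype.card ι := by exact_mod_cast Fintype.card_pos
  set N : ℝ := (Fintype.card ι : ℝ)
  have hw : A w = ∑ ν, w ν • A (EuclideanSpace.single ν 1) := by
    conv_lhs => rw [← (EuclideanSpace.basisFun ι ℝ).sum_repr w]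
    simp
  have hcomp (i : ι) : |A w i| ≤ 1 / (2 * N) * ∑ ν, |w ν| := by
    rw [hw, WithLp.ofLp_sum, Finset.sum_apply, Finset.mul_sum]
    refine (Finset.abs_sum_le_sum_abs _ _).trans (Finset.sum_le_sum fun ν _ => ?_)
    rw [PiLp.smul_apply, smul_eq_mul, abs_mul, mul_comm]
    exact mul_le_mul_of_nonneg_right (hA ν i) (abs_nonneg _)
  have hcs : (∑ ν, |w ν|) ^ 2 ≤ N * ‖w‖ ^ 2 := by
    rw [EuclideanSpace.norm_sq_eq]
    exact sq_sum_le_card_mul_sum_sq (s := Finset.univ) (f := fun ν => |w ν|)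
  refine abs_le_of_sq_le_sq' ?_ (by positivity) |>.2
  rw [EuclideanSpace.norm_sq_eq]
  calc ∑ i, ‖A w i‖ ^ 2 ≤ ∑ _i : ι, (1 / (2 * N)) ^ 2 * (N * ‖w‖ ^ 2) := by
        refine Finset.sum_le_sum fun i _ => ?_
        refine (pow_le_pow_left₀ (norm_nonneg _) (hcomp i) 2).trans ?_
        rw [mul_pow]
        exact mul_le_mul_of_nonneg_left hcs (by positivity)
    _ = (1 / 2 * ‖w‖) ^ 2 := by
        rw [Finset.sum_const, nsmul_eq_mul, Finset.card_univ]
        change N * _ = _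
        field_simp

/-- An injective `C¹` map on an open set whose derivatives are injective is a diffeomorphism onto
its open image. -/
theorem exists_openPartialHomeomorph {E : Type*} [NormedAddCommGroup E] [NormedSpace ℝ E]
    [FiniteDimensional ℝ E] {f : E → E} {s : Set E} (hs : IsOpen s) (hf : ContDiffOn ℝ 1 f s)
    (hinj : InjOn f s) (hd : ∀ x ∈ s, ∀ y, fderiv ℝ f x y = 0 → y = 0) :
    ∃ e : OpenPartialHomeomorph E E, e.source = s ∧ (e : E → E) = f ∧ e.target = f '' s ∧
      ContDiffOn ℝ 1 e.symm e.target := by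
  have : CompleteSpace E := FiniteDimensional.complete ℝ E
  have hequiv : ∀ x ∈ s, ∃ f' : E ≃L[ℝ] E, HasStrictFDerivAt f (f' : E →L[ℝ] E) x := by
    intro x hx
    let l : E ≃L[ℝ] E := (LinearEquiv.ofInjectiveEndo (fderiv ℝ f x).toLinearMap
      ((injective_iff_map_eq_zero _).2 (hd x hx))).toContinuousLinearEquiv
    have hl : (l : E →L[ℝ] E) = fderiv ℝ f x := by ext; rfl
    exact ⟨l, by
      rw [hl]
      exact (hf.contDiffAt (hs.mem_nhds hx)).hasStrictFDerivAt (by simp)⟩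
  -- Local openness comes from the inverse function theorem; with injectivity it gives a continuous
  -- global inverse.
  have hopen : IsOpenMap (s.domRestrict f) := by
    rw [isOpenMap_iff_nhds_le]
    rintro ⟨x, hx⟩
    obtain ⟨f', hf'⟩ := hequiv x hx
    have h1 : map (s.domRestrict f) (𝓝 ⟨x, hx⟩) = map f (map Subtype.val (𝓝 ⟨x, hx⟩)) := rfl
    rw [h1, map_nhds_subtype_coe_eq_nhds hx (hs.mem_nhds hx), hf'.map_nhds_eq_of_equiv]
    exact le_rfl
  let e := OpenPartialHomeomorph.ofContinuousOpenRestrict (hinj.toPartialEquiv f s)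
    hf.continuousOn hopen hs
  refine ⟨e, rfl, rfl, rfl, fun y hy => ?_⟩
  have hys : e.symm y ∈ s := e.map_target hy
  obtain ⟨f', hf'⟩ := hequiv _ hys
  exact (e.contDiffAt_symm hy hf'.hasFDerivAt
    (hf.contDiffAt (hs.mem_nhds hys))).contDiffWithinAt

/-! ### The finite-dimensional maps `S_r` -/

namespace System

variable {h : ℝ} {n k : ℕ} {F : Type*} [NormedAddCommGroup F] [NormedSpace ℝ F]
  (S : System h n k F) (χ : Fin n → Rn k × Rkn k n → C1 h ℝ)

/-- The perturbation `R(r,v)` of the identity in `S_r(v) = v - R(r,v)`. -/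
def R (p : Rn k × Rkn k n) : Rkn k n :=
  WithLp.toLp 2 fun i => S.g p.2 i.2 * oddExt (incl (χ i.2 p)) (p.1 i.1)

/-- The function `g(v) ⊙ χ(r,v)` subtracted in the definition of `T`. -/
def shift (p : Rn k × Rkn k n) : C1 h (Rn n) := vec1 fun j => S.g p.2 j • χ j p

theorem hat_shift (r : Rn k) (v : Rkn k n) : hat r (incl (S.shift χ (r, v))) = S.R χ (r, v) := by
  ext i
  show oddExt (S.g v i.2 • incl (χ i.2 (r, v))) (r i.1) = S.g v i.2 * _
  rw [← oddL_apply, map_smul, oddL_apply, smul_eq_mul]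

variable {S χ}

theorem vec_eq_sum (f : Fin n → C0 h ℝ) : vec f = ∑ j, vec (Pi.single j (f j)) := by
  have := map_sum (vecL h n) (fun j => Pi.single j (f j)) Finset.univ
  rw [Finset.univ_sum_single] at this
  exact this

namespace IsAdmissible

theorem Q_shift (hχ : S.IsAdmissible χ) {r : Rn k} (hr : r ∈ S.Ik) {v : Rkn k n} (hv : v ∈ S.V) :
    S.Q (r, incl (S.shift χ (r, v))) = 0 := by
  let l := (S.linear_Q r (S.Ik_subset hr)).mk' _
  have e (j : Fin n) : vec (Pi.single j (S.g v j • incl (χ j (r, v))))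
      = S.g v j • vec (Pi.single j (incl (χ j (r, v)))) := by
    rw [Pi.single_smul']
    exact map_smul (vecL h n) _ _
  have h1 : incl (S.shift χ (r, v)) = ∑ j, S.g v j • vec (Pi.single j (incl (χ j (r, v)))) := by
    rw [shift, incl_vec1, vec_eq_sum]
    exact Finset.sum_congr rfl fun j _ => e j
  have h2 : l (incl (S.shift χ (r, v))) = 0 := by
    rw [h1, map_sum]
    refine Finset.sum_eq_zero fun j _ => ?_
    rw [map_smul]
    show S.g v j • S.Q (r, vec (Pi.single j (incl (χ j (r, v))))) = 0
    rw [hχ.Q_eq_zero j r hr v hv, smul_zero]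
  exact h2

theorem Q_add_shift (hχ : S.IsAdmissible χ) {r : Rn k} (hr : r ∈ S.Ik) {v : Rkn k n}
    (hv : v ∈ S.V) (ψ : C1 h (Rn n)) :
    S.Q (r, incl (ψ + S.shift χ (r, v))) = S.Q (r, incl ψ) := by
  have h1 := (S.linear_Q r (S.Ik_subset hr)).map_add (incl ψ) (incl (S.shift χ (r, v)))
  rw [hχ.Q_shift hr hv, add_zero] at h1
  exact h1

theorem ev_der_shift (hχ : S.IsAdmissible χ) {r : Rn k} (hr : r ∈ S.Ik) {v : Rkn k n}
    (hv : v ∈ S.V) : ev (der (S.shift χ (r, v))) 0 = S.g v := by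
  show ev (vec fun j => der (S.g v j • χ j (r, v))) 0 = _
  rw [ev_vec]
  ext j
  show ev (S.g v j • der (χ j (r, v))) 0 = _
  rw [ev_smul, Pi.smul_apply, hχ.der_eq_one j r hr v hv, smul_eq_mul, mul_one]

theorem contDiffOn_shift (hχ : S.IsAdmissible χ) : ContDiffOn ℝ 1 (S.shift χ) (S.Ik ×ˢ S.V) := by
  have h1 : ContDiffOn ℝ 1 (fun p : Rn k × Rkn k n => fun j => S.g p.2 j • χ j p)
      (S.Ik ×ˢ S.V) := by
    refine contDiffOn_pi.2 fun j => ?_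
    have h2 : ContDiffOn ℝ 1 (fun p : Rn k × Rkn k n => S.g p.2) (S.Ik ×ˢ S.V) :=
      S.contDiffOn_g.comp contDiffOn_snd fun p hp => hp.2
    exact (contDiffOn_euclidean.1 h2 j).smul (hχ.contDiffOn j)
  exact (vec1L h n).contDiff.comp_contDiffOn h1

theorem contDiffOn_R (hh : 0 < h) (hχ : S.IsAdmissible χ) :
    ContDiffOn ℝ 1 (S.R χ) (S.Ik ×ˢ S.V) := by
  have := (contDiffOn_hat (n := n) hh).comp (contDiffOn_fst.prodMk hχ.contDiffOn_shift)
    fun p (hp : p ∈ S.Ik ×ˢ S.V) => ⟨S.Ik_subset_cube hp.1, mem_univ _⟩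
  exact this.congr fun p _ => (S.hat_shift χ p.1 p.2).symm

end IsAdmissible

/-- The constant `6 k n` in `h_g` is `3 · 2 · k n`: the odd extension multiplies norms by at most
`3`, there are `k n` coordinates, and the target is one half. -/
theorem hg_spec (hn : 0 < n) (hk : 0 < k) {v : Rkn k n} (hv : v ∈ S.V) :
    0 < S.hg v ∧ ∃ X Y : ℝ, 0 ≤ X ∧ 0 ≤ Y ∧
      (∀ i j, |fderiv ℝ S.g v (EuclideanSpace.single i 1) j| ≤ X) ∧ (∀ j, |S.g v j| ≤ Y) ∧
      3 * S.hg v * (1 + X + Y) = S.margin v / (2 * (k * n)) := by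
  have hn' : (0 : ℝ) < n := by exact_mod_cast hn
  have hk' : (0 : ℝ) < k := by exact_mod_cast hk
  have b3 : 0 ≤ ⨆ i : (Fin k × Fin n) × Fin n,
      |fderiv ℝ S.g v (EuclideanSpace.single i.1 1) i.2| := Real.iSup_nonneg fun _ => abs_nonneg _
  have b4 : 0 ≤ ⨆ j : Fin n, |S.g v j| := Real.iSup_nonneg fun _ => abs_nonneg _
  have hm := S.margin_pos hv
  have e : S.hg v = S.margin v / (6 * k * n * (1 + (⨆ i : (Fin k × Fin n) × Fin n,
      |fderiv ℝ S.g v (EuclideanSpace.single i.1 1) i.2|) + ⨆ j : Fin n, |S.g v j|)) := rfl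
  refine ⟨by rw [e]; positivity, _, _, b3, b4, S.abs_fderiv_g_le_iSup v, S.abs_g_le_iSup v, ?_⟩
  rw [e]
  field_simp
  norm_num

namespace IsAdmissible

theorem norm_R_lt (hn : 0 < n) (hk : 0 < k) (hχ : S.IsAdmissible χ) {r : Rn k} (hr : r ∈ S.Ik)
    {v : Rkn k n} (hv : v ∈ S.V) : ‖S.R χ (r, v)‖ < S.margin v / 2 := by
  have : Nonempty (Fin k × Fin n) := ⟨⟨0, hk⟩, ⟨0, hn⟩⟩
  have hn' : (0 : ℝ) < n := by exact_mod_cast hn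
  have hk' : (0 : ℝ) < k := by exact_mod_cast hk
  obtain ⟨h0, X, Y, hX, hY, -, hgY, hXY⟩ := hg_spec hn hk hv
  have hi (i : Fin k × Fin n) : |S.R χ (r, v) i| < S.margin v / (2 * (k * n)) := by
    rw [← hXY]
    show |S.g v i.2 * oddExt (incl (χ i.2 (r, v))) (r i.1)| < _
    rw [abs_mul]
    calc |S.g v i.2| * |oddExt (incl (χ i.2 (r, v))) (r i.1)|
        ≤ Y * (3 * S.hg v) := by
          refine mul_le_mul (hgY _) ((abs_oddExt_le _ _).trans ?_) (abs_nonneg _) hY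
          exact mul_le_mul_of_nonneg_left (hχ.norm_le _ r hr v hv) (by norm_num)
      _ < 3 * S.hg v * (1 + X + Y) := by nlinarith
  calc ‖S.R χ (r, v)‖ ≤ ∑ i, |S.R χ (r, v) i| := euclidean_norm_le_sum_abs _
    _ < ∑ _i : Fin k × Fin n, S.margin v / (2 * (k * n)) :=
        Finset.sum_lt_sum_of_nonempty Finset.univ_nonempty fun i _ => hi i
    _ = S.margin v / 2 := by
        rw [Finset.sum_const, nsmul_eq_mul, Finset.card_univ, Fintype.card_prod, Fintype.card_fin,
          Fintype.card_fin]
        push_cast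
        field_simp

theorem differentiableAt_R (hh : 0 < h) (hχ : S.IsAdmissible χ) {r : Rn k} (hr : r ∈ S.Ik)
    {v : Rkn k n} (hv : v ∈ S.V) : DifferentiableAt ℝ (fun w => S.R χ (r, w)) v := by
  have h1 : ContDiffOn ℝ 1 (fun w => S.R χ (r, w)) S.V :=
    (hχ.contDiffOn_R hh).comp (contDiff_const.prodMk contDiff_id).contDiffOn
      fun w hw => ⟨hr, hw⟩
  exact (h1.differentiableOn (by simp)).differentiableAt (S.isOpen_V.mem_nhds hv)

/-- By the product rule each matrix entry is at most `3 h_g (X + Y)`, hence at most `1 / (2 k n)`,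
and Cauchy–Schwarz turns this into an operator bound. -/
theorem norm_fderiv_R_le (hh : 0 < h) (hn : 0 < n) (hk : 0 < k) (hχ : S.IsAdmissible χ)
    {r : Rn k} (hr : r ∈ S.Ik) {v : Rkn k n} (hv : v ∈ S.V) :
    ‖fderiv ℝ (fun w => S.R χ (r, w)) v‖ ≤ 1 / 2 := by
  refine ContinuousLinearMap.opNorm_le_bound _ (by norm_num) fun w => ?_
  refine euclidean_norm_apply_le_half _ (fun ν i => ?_) w
  have hn' : (0 : ℝ) < n := by exact_mod_cast hn
  have hk' : (0 : ℝ) < k := by exact_mod_cast hk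
  obtain ⟨h0, X, Y, hX, hY, hgX, hgY, hXY⟩ := hg_spec hn hk hv
  have hdχ : DifferentiableAt ℝ (fun w => χ i.2 (r, w)) v := by
    have h1 : ContDiffOn ℝ 1 (fun w => χ i.2 (r, w)) S.V :=
      (hχ.contDiffOn i.2).comp (contDiff_const.prodMk contDiff_id).contDiffOn
        fun w hw => ⟨hr, hw⟩
    exact (h1.differentiableOn (by simp)).differentiableAt (S.isOpen_V.mem_nhds hv)
  have hdg : DifferentiableAt ℝ S.g v :=
    (S.contDiffOn_g.differentiableOn (by simp)).differentiableAt (S.isOpen_V.mem_nhds hv)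
  have d1 : HasFDerivAt (fun w => S.R χ (r, w) i) ((EuclideanSpace.proj (𝕜 := ℝ) i).comp
      (fderiv ℝ (fun w => S.R χ (r, w)) v)) v :=
    (EuclideanSpace.proj (𝕜 := ℝ) i).hasFDerivAt.comp v
      (hχ.differentiableAt_R hh hr hv).hasFDerivAt
  have d2 : HasFDerivAt (fun w => S.g w i.2)
      ((EuclideanSpace.proj (𝕜 := ℝ) i.2).comp (fderiv ℝ S.g v)) v :=
    (EuclideanSpace.proj (𝕜 := ℝ) i.2).hasFDerivAt.comp v hdg.hasFDerivAt
  have d3 : HasFDerivAt (fun w => oddL h (r i.1) (inclL h ℝ (χ i.2 (r, w))))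
      (((oddL h (r i.1)).comp (inclL h ℝ)).comp (fderiv ℝ (fun w => χ i.2 (r, w)) v)) v :=
    ((oddL h (r i.1)).comp (inclL h ℝ)).hasFDerivAt.comp v hdχ.hasFDerivAt
  have d4 : HasFDerivAt (fun w => S.R χ (r, w) i) _ v :=
    (d2.mul d3).congr_of_eventuallyEq (Eventually.of_forall fun w => by
      show S.g w i.2 * oddExt _ _ = S.g w i.2 * oddL h _ _
      rw [oddL_apply]; rfl)
  have e := DFunLike.congr_fun (d1.unique d4) (EuclideanSpace.single ν 1)
  have e' : fderiv ℝ (fun w => S.R χ (r, w)) v (EuclideanSpace.single ν 1) i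
      = S.g v i.2 * oddExt (incl (fderiv ℝ (fun w => χ i.2 (r, w)) v
          (EuclideanSpace.single ν 1))) (r i.1)
        + oddExt (incl (χ i.2 (r, v))) (r i.1)
          * fderiv ℝ S.g v (EuclideanSpace.single ν 1) i.2 := by
    rw [← oddL_apply, ← oddL_apply]
    exact e
  have b (f : C0 h ℝ) (hf : ‖f‖ ≤ S.hg v) : |oddExt f (r i.1)| ≤ 3 * S.hg v :=
    (abs_oddExt_le _ _).trans (mul_le_mul_of_nonneg_left hf (by norm_num))
  have hm : S.margin v / (2 * (k * n)) ≤ 1 / (2 * (k * n)) :=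
    div_le_div_of_nonneg_right (S.margin_le_one v) (by positivity)
  rw [e', Fintype.card_prod, Fintype.card_fin, Fintype.card_fin]
  push_cast
  refine le_trans ?_ hm
  rw [← hXY]
  refine (abs_add_le _ _).trans ?_
  rw [abs_mul, abs_mul]
  have b1 := mul_le_mul (hgY i.2) (b _ (hχ.norm_partial_le i.2 r hr v hv ν)) (abs_nonneg _) hY
  have b2 := mul_le_mul (b _ (hχ.norm_le i.2 r hr v hv)) (hgX ν i.2) (abs_nonneg _)
    (by positivity)
  nlinarith

/-- `V` need not be convex. But if `S_r(v) = S_r(w)`, then `w - v` is a difference of two values of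
`R`, so `w` lies in the ball about `v` whose radius is the larger margin. This ball is contained in
`V`, and there `R` is a contraction. -/
theorem injOn_Smap (hh : 0 < h) (hn : 0 < n) (hk : 0 < k) (hχ : S.IsAdmissible χ) {r : Rn k}
    (hr : r ∈ S.Ik) : InjOn (S.Smap χ r) S.V := by
  have key : ∀ v ∈ S.V, ∀ w ∈ S.V, S.margin w ≤ S.margin v → S.Smap χ r v = S.Smap χ r w →
      v = w := by
    intro v hv w hw hm he
    have he' : v - S.R χ (r, v) = w - S.R χ (r, w) := he
    have hd : w - v = S.R χ (r, w) - S.R χ (r, v) := by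
      rw [sub_eq_sub_iff_add_eq_add] at he' ⊢
      rw [← he', add_comm]
    have h1 : ‖w - v‖ < S.margin v := by
      rw [hd]
      have := norm_sub_le (S.R χ (r, w)) (S.R χ (r, v))
      have a := hχ.norm_R_lt hn hk hr hv
      have b := hχ.norm_R_lt hn hk hr hw
      linarith
    have hsub := S.ball_margin_subset v
    have h2 : ‖S.R χ (r, w) - S.R χ (r, v)‖ ≤ 1 / 2 * ‖w - v‖ :=
      Convex.norm_image_sub_le_of_norm_hasFDerivWithin_le
        (fun x hx => (hχ.differentiableAt_R hh hr (hsub hx)).hasFDerivAt.hasFDerivWithinAt)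
        (fun x hx => hχ.norm_fderiv_R_le hh hn hk hr (hsub hx)) (convex_ball v (S.margin v))
        (Metric.mem_ball_self (S.margin_pos hv)) (by rwa [Metric.mem_ball, dist_eq_norm])
    rw [← hd] at h2
    have h3 : ‖w - v‖ = 0 := by linarith [norm_nonneg (w - v)]
    exact (sub_eq_zero.1 (norm_eq_zero.1 h3)).symm
  intro v hv w hw he
  rcases le_total (S.margin w) (S.margin v) with hm | hm
  · exact key v hv w hw hm he
  · exact (key w hw v hv hm he.symm).symm

/-- The map `(r,v) ↦ (r, S_r(v))` is a diffeomorphism of `I^k × V` onto its open image. -/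
theorem exists_Smap_diffeo (hh : 0 < h) (hn : 0 < n) (hk : 0 < k) (hχ : S.IsAdmissible χ) :
    ∃ e : OpenPartialHomeomorph (Rn k × Rkn k n) (Rn k × Rkn k n),
      e.source = S.Ik ×ˢ S.V ∧ (∀ p, e p = (p.1, S.Smap χ p.1 p.2)) ∧
      (∀ p, p ∈ e.target ↔ p.1 ∈ S.Ik ∧ p.2 ∈ S.Smap χ p.1 '' S.V) ∧
      ContDiffOn ℝ 1 e.symm e.target := by
  have hR := hχ.contDiffOn_R hh
  have hopen : IsOpen (S.Ik ×ˢ S.V) := S.isOpen_Ik.prod S.isOpen_V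
  let f : Rn k × Rkn k n → Rn k × Rkn k n := fun p => (p.1, p.2 - S.R χ p)
  have hf : ContDiffOn ℝ 1 f (S.Ik ×ˢ S.V) := contDiffOn_fst.prodMk (contDiffOn_snd.sub hR)
  have hinj : InjOn f (S.Ik ×ˢ S.V) := by
    rintro ⟨r, v⟩ ⟨hr, hv⟩ ⟨r', w⟩ ⟨-, hw⟩ he
    obtain ⟨h1, h2⟩ := Prod.mk.inj he
    simp only at h1
    subst h1
    exact Prod.ext rfl (hχ.injOn_Smap hh hn hk hr hv hw h2)
  -- The derivative is block triangular: the first component forces `ρ = 0`, and then `w = D₂R w`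
  -- with `‖D₂R‖ ≤ 1/2` forces `w = 0`.
  have hd : ∀ x ∈ S.Ik ×ˢ S.V, ∀ y, fderiv ℝ f x y = 0 → y = 0 := by
    rintro ⟨r, v⟩ ⟨hr, hv⟩ ⟨ρ, w⟩ hy
    have hRd : DifferentiableAt ℝ (S.R χ) (r, v) :=
      (hR.differentiableOn (by simp)).differentiableAt (hopen.mem_nhds ⟨hr, hv⟩)
    have hfd : HasFDerivAt f ((ContinuousLinearMap.fst ℝ _ _).prod
        (ContinuousLinearMap.snd ℝ _ _ - fderiv ℝ (S.R χ) (r, v))) (r, v) :=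
      hasFDerivAt_fst.prodMk (hasFDerivAt_snd.sub hRd.hasFDerivAt)
    rw [hfd.fderiv] at hy
    obtain ⟨h1, h2⟩ := Prod.mk.inj hy
    have h1' : ρ = 0 := h1
    have h2' : w - fderiv ℝ (S.R χ) (r, v) (ρ, w) = 0 := h2
    subst h1'
    have d : HasFDerivAt (fun w => S.R χ (r, w))
        ((fderiv ℝ (S.R χ) (r, v)).comp (ContinuousLinearMap.inr ℝ _ _)) v :=
      hRd.hasFDerivAt.comp v (hasFDerivAt_prodMk_right r v)
    have hw : w = fderiv ℝ (fun w => S.R χ (r, w)) v w := by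
      rw [d.fderiv]
      exact sub_eq_zero.1 h2'
    have h3 : ‖w‖ ≤ 1 / 2 * ‖w‖ := by
      conv_lhs => rw [hw]
      exact ContinuousLinearMap.le_of_opNorm_le _ (hχ.norm_fderiv_R_le hh hn hk hr hv) w
    have h4 : ‖w‖ = 0 := by linarith [norm_nonneg w]
    rw [norm_eq_zero.1 h4]
    rfl
  obtain ⟨e, h1, h2, h3, h4⟩ := exists_openPartialHomeomorph hopen hf hinj hd
  refine ⟨e, h1, fun p => by rw [h2]; rfl, fun p => ?_, h4⟩
  rw [h3]
  constructor
  · rintro ⟨q, hq, rfl⟩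
    exact ⟨hq.1, q.2, hq.2, rfl⟩
  · rintro ⟨hr, v, hv, he⟩
    exact ⟨(p.1, v), ⟨hr, hv⟩, Prod.ext rfl he⟩

end IsAdmissible

end System

/-! ### The diffeomorphism `T` and the image of the solution manifold -/

namespace System

variable {h : ℝ} {n k : ℕ} {F : Type*} [NormedAddCommGroup F] [NormedSpace ℝ F]
  {S : System h n k F} {χ : Fin n → Rn k × Rkn k n → C1 h ℝ}

theorem contDiffOn_hat_Ik (hh : 0 < h) (S : System h n k F) :
    ContDiffOn ℝ 1 (fun p : Rn k × C1 h (Rn n) => hat p.1 (incl p.2)) (S.Ik ×ˢ univ) :=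
  (contDiffOn_hat hh).mono (prod_mono S.Ik_subset_cube Subset.rfl)

theorem isOpen_U (hh : 0 < h) (S : System h n k F) : IsOpen S.U := by
  have h1 := ((S.contDiffOn_hat_Ik hh).continuousOn.prodMk
    S.contDiffOn_Q.continuousOn).isOpen_inter_preimage (S.isOpen_Ik.prod isOpen_univ)
    (S.isOpen_V.prod S.isOpen_W)
  have e : S.U = S.Ik ×ˢ univ ∩
      (fun p : Rn k × C1 h (Rn n) => (hat p.1 (incl p.2), S.Q (p.1, incl p.2))) ⁻¹' S.V ×ˢ S.W := by
    ext p
    exact ⟨fun hp => ⟨⟨hp.1, mem_univ _⟩, hp.2⟩, fun hp => ⟨hp.1.1, hp.2⟩⟩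
  rw [e]
  exact h1

namespace IsAdmissible

theorem T_eq (χ : Fin n → Rn k × Rkn k n → C1 h ℝ) (p : Rn k × C1 h (Rn n)) :
    S.T χ p = (p.1, p.2 - S.shift χ (p.1, hat p.1 (incl p.2))) := rfl

theorem hat_T (χ : Fin n → Rn k × Rkn k n → C1 h ℝ) (p : Rn k × C1 h (Rn n)) :
    hat p.1 (incl (S.T χ p).2) = S.Smap χ p.1 (hat p.1 (incl p.2)) := by
  show hat p.1 (incl p.2 - incl (S.shift χ (p.1, hat p.1 (incl p.2)))) = _
  rw [hat_sub, hat_shift]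
  rfl

theorem Q_T (hχ : S.IsAdmissible χ) {p : Rn k × C1 h (Rn n)} (hp : p ∈ S.U) :
    S.Q (p.1, incl (S.T χ p).2) = S.Q (p.1, incl p.2) := by
  have := hχ.Q_add_shift hp.1 hp.2.1 (S.T χ p).2
  rw [T_eq, sub_add_cancel] at this
  exact this.symm

theorem hat_add_shift {r : Rn k} {v : Rkn k n} {ψ : C1 h (Rn n)}
    (he : S.Smap χ r v = hat r (incl ψ)) : hat r (incl (ψ + S.shift χ (r, v))) = v := by
  have h1 : hat r (incl ψ) = hat r (incl (ψ + S.shift χ (r, v))) - S.R χ (r, v) := by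
    rw [← hat_shift, ← hat_sub]
    congr 1
    exact (add_sub_cancel_right (incl ψ) (incl (S.shift χ (r, v)))).symm
  have h2 : v - S.R χ (r, v) = hat r (incl (ψ + S.shift χ (r, v))) - S.R χ (r, v) :=
    Eq.trans he h1
  exact (sub_left_injective h2).symm

/-- `T` is a diffeomorphism of `𝒰` onto `𝒪`. -/
theorem exists_T_diffeo (hh : 0 < h) (hn : 0 < n) (hk : 0 < k) (hχ : S.IsAdmissible χ) :
    ∃ T : OpenPartialHomeomorph (Rn k × C1 h (Rn n)) (Rn k × C1 h (Rn n)),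
      T.source = S.U ∧ T.target = S.O χ ∧ (∀ p, T p = S.T χ p) ∧
      ContDiffOn ℝ 1 T S.U ∧ ContDiffOn ℝ 1 T.symm (S.O χ) := by
  obtain ⟨e, hes, he, het, hed⟩ := hχ.exists_Smap_diffeo hh hn hk
  -- For `(r,ψ) ∈ 𝒪` this is the delayed vector of the preimage under `T`, computed from that of `ψ`
  -- by inverting `S_r`.
  let v : Rn k × C1 h (Rn n) → Rkn k n := fun p => (e.symm (p.1, hat p.1 (incl p.2))).2
  have htar : ∀ p ∈ S.O χ, (p.1, hat p.1 (incl p.2)) ∈ e.target := fun p hp =>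
    (het _).2 ⟨hp.1, hp.2.2⟩
  have hsymm : ∀ p ∈ S.O χ, e.symm (p.1, hat p.1 (incl p.2)) = (p.1, v p) := fun p hp => by
    have h1 := e.right_inv (htar p hp)
    rw [he] at h1
    exact Prod.ext (Prod.mk.inj h1).1 rfl
  have hv : ∀ p ∈ S.O χ, v p ∈ S.V ∧ S.Smap χ p.1 (v p) = hat p.1 (incl p.2) := by
    intro p hp
    have h1 := e.map_target (htar p hp)
    have h2 := e.right_inv (htar p hp)
    rw [hsymm p hp, hes] at h1
    rw [hsymm p hp, he] at h2
    exact ⟨h1.2, (Prod.mk.inj h2).2⟩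
  have hvT : ∀ p ∈ S.U, v (S.T χ p) = hat p.1 (incl p.2) := by
    intro p hp
    have h1 : (p.1, hat p.1 (incl p.2)) ∈ e.source := by rw [hes]; exact ⟨hp.1, hp.2.1⟩
    have h2 := e.left_inv h1
    rw [he, ← hat_T] at h2
    exact (Prod.mk.inj h2).2
  let Tinv : Rn k × C1 h (Rn n) → Rn k × C1 h (Rn n) := fun p =>
    (p.1, p.2 + S.shift χ (p.1, v p))
  have hTmap : ∀ p ∈ S.U, S.T χ p ∈ S.O χ := fun p hp =>
    ⟨hp.1, by
      show S.Q (p.1, incl (S.T χ p).2) ∈ S.W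
      rw [hχ.Q_T hp]; exact hp.2.2, hat p.1 (incl p.2), hp.2.1, (hat_T χ p).symm⟩
  have hhat : ∀ p ∈ S.O χ, hat p.1 (incl (Tinv p).2) = v p := fun p hp =>
    hat_add_shift (hv p hp).2
  have hTinvmap : ∀ p ∈ S.O χ, Tinv p ∈ S.U := by
    intro p hp
    refine ⟨hp.1, ?_, ?_⟩
    · show hat p.1 (incl (Tinv p).2) ∈ S.V
      rw [hhat p hp]
      exact (hv p hp).1
    · show S.Q (p.1, incl (p.2 + S.shift χ (p.1, v p))) ∈ S.W
      rw [hχ.Q_add_shift hp.1 (hv p hp).1]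
      exact hp.2.1
  have hshift : ContDiffOn ℝ 1
      (fun p : Rn k × C1 h (Rn n) => S.shift χ (p.1, hat p.1 (incl p.2))) S.U :=
    hχ.contDiffOn_shift.comp (contDiffOn_fst.prodMk
      ((S.contDiffOn_hat_Ik hh).mono fun p hp => ⟨hp.1, mem_univ _⟩)) fun p hp => ⟨hp.1, hp.2.1⟩
  have hT : ContDiffOn ℝ 1 (S.T χ) S.U := contDiffOn_fst.prodMk (contDiffOn_snd.sub hshift)
  have hhatO : ContDiffOn ℝ 1 (fun p : Rn k × C1 h (Rn n) => (p.1, hat p.1 (incl p.2)))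
      (S.O χ) :=
    contDiffOn_fst.prodMk ((S.contDiffOn_hat_Ik hh).mono fun p hp => ⟨hp.1, mem_univ _⟩)
  have hvd : ContDiffOn ℝ 1 v (S.O χ) := contDiff_snd.comp_contDiffOn (hed.comp hhatO htar)
  have hTinv : ContDiffOn ℝ 1 Tinv (S.O χ) :=
    contDiffOn_fst.prodMk (contDiffOn_snd.add
      (hχ.contDiffOn_shift.comp (contDiffOn_fst.prodMk hvd) fun p hp => ⟨hp.1, (hv p hp).1⟩))
  have hO : IsOpen (S.O χ) := by
    have h1 := ((continuousOn_fst.prodMk (S.contDiffOn_hat_Ik hh).continuousOn).prodMk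
      S.contDiffOn_Q.continuousOn).isOpen_inter_preimage (S.isOpen_Ik.prod isOpen_univ)
      (e.open_target.prod S.isOpen_W)
    have e : S.O χ = S.Ik ×ˢ univ ∩ (fun p : Rn k × C1 h (Rn n) =>
        ((p.1, hat p.1 (incl p.2)), S.Q (p.1, incl p.2))) ⁻¹' e.target ×ˢ S.W := by
      ext p
      constructor
      · exact fun hp => ⟨⟨hp.1, mem_univ _⟩, htar p hp, hp.2.1⟩
      · exact fun hp => ⟨hp.1.1, hp.2.2, ((het _).1 hp.2.1).2⟩
    rw [e]
    exact h1
  refine ⟨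
    { toFun := S.T χ
      invFun := Tinv
      source := S.U
      target := S.O χ
      map_source' := hTmap
      map_target' := hTinvmap
      left_inv' := fun p hp => ?_
      right_inv' := fun p hp => ?_
      open_source := S.isOpen_U hh
      open_target := hO
      continuousOn_toFun := hT.continuousOn
      continuousOn_invFun := hTinv.continuousOn }, rfl, rfl, fun p => rfl, hT, hTinv⟩
  · show (p.1, (S.T χ p).2 + S.shift χ (p.1, v (S.T χ p))) = p
    rw [hvT p hp, T_eq, sub_add_cancel]
  · show (p.1, (Tinv p).2 - S.shift χ (p.1, hat p.1 (incl (Tinv p).2))) = p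
    rw [hhat p hp]
    exact Prod.ext rfl (add_sub_cancel_right _ _)

theorem Delta_T (hχ : S.IsAdmissible χ) {p : Rn k × C1 h (Rn n)} (hp : p ∈ S.U) :
    S.Delta (S.T χ p) = S.Delta p := by
  show S.δ (p.1, S.Q (p.1, incl (S.T χ p).2)) = _
  rw [hχ.Q_T hp]
  rfl

theorem ev_der_T (hχ : S.IsAdmissible χ) {p : Rn k × C1 h (Rn n)} (hp : p ∈ S.U) :
    ev (der (S.T χ p).2) 0 = ev (der p.2) 0 - S.G p := by
  have h1 : ev (der (S.T χ p).2) 0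
      = evL h (Rn n) 0 (derL h _ p.2 - derL h _ (S.shift χ (p.1, hat p.1 (incl p.2)))) := rfl
  rw [h1, map_sub, derL_apply, derL_apply, evL_apply, evL_apply, hχ.ev_der_shift hp.1 hp.2.1]
  rfl

/-- The determinant is taken at `T.symm p`, the original point, so it transfers verbatim; only the
two equations need the transformation rules for `Delta` and the slope at `0`. -/
theorem image_T_M (hχ : S.IsAdmissible χ)
    {T : OpenPartialHomeomorph (Rn k × C1 h (Rn n)) (Rn k × C1 h (Rn n))}
    (hs : T.source = S.U) (ht : T.target = S.O χ) (hT : ∀ p, T p = S.T χ p) :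
    S.T χ '' S.M = {p | p ∈ S.O χ ∧ ev (der p.2) 0 = 0 ∧ S.Delta p = 0 ∧
      (S.D1Delta (T.symm p)).det ≠ 0} := by
  ext p
  constructor
  · rintro ⟨q, ⟨hqU, hq1, hq2, hq3⟩, rfl⟩
    have hqs : q ∈ T.source := hs ▸ hqU
    have e : T.symm (S.T χ q) = q := by rw [← hT, T.left_inv hqs]
    refine ⟨?_, ?_, ?_, ?_⟩
    · rw [← ht, ← hT]; exact T.map_source hqs
    · rw [hχ.ev_der_T hqU, hq1, sub_self]
    · rw [hχ.Delta_T hqU, hq2]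
    · rwa [e]
  · rintro ⟨hp, hp1, hp2, hp3⟩
    have hpt : p ∈ T.target := ht ▸ hp
    have hqU : T.symm p ∈ S.U := hs ▸ T.map_target hpt
    have e : S.T χ (T.symm p) = p := by rw [← hT, T.right_inv hpt]
    refine ⟨T.symm p, ⟨hqU, ?_, ?_, hp3⟩, e⟩
    · have := hχ.ev_der_T hqU
      rw [e, hp1] at this
      exact sub_eq_zero.1 this.symm
    · rw [← hχ.Delta_T hqU, e, hp2]

end IsAdmissible

end System

end AlgDelay

end

theorem corollary4p4 {h : ℝ} (hh : 0 < h) {n k : ℕ} (hn : 0 < n) (hk : 0 < k)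
    {F : Type*} [NormedAddCommGroup F] [NormedSpace ℝ F] [FiniteDimensional ℝ F]
    (S : AlgDelay.System h n k F) :
    (∃ χ, S.IsAdmissible χ) ∧
    ∀ χ, S.IsAdmissible χ →
      ∃ T : OpenPartialHomeomorph (AlgDelay.Rn k × AlgDelay.C1 h (AlgDelay.Rn n))
          (AlgDelay.Rn k × AlgDelay.C1 h (AlgDelay.Rn n)),
        T.source = S.U ∧ T.target = S.O χ ∧ Set.EqOn T (S.T χ) S.U ∧
        ContDiffOn ℝ 1 T S.U ∧ ContDiffOn ℝ 1 T.symm (S.O χ) ∧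
        S.T χ '' S.M =
          {p | p ∈ S.O χ ∧ AlgDelay.ev (AlgDelay.der p.2) 0 = 0 ∧ S.Delta p = 0 ∧
            (S.D1Delta (T.symm p)).det ≠ 0} ∧
        S.T χ '' S.M =
          {p | p ∈ (S.Ik ×ˢ AlgDelay.X0 h n) ∩ S.O χ ∧ S.Delta p = 0 ∧
            (S.D1Delta (T.symm p)).det ≠ 0} := by
  refine ⟨S.exists_isAdmissible hh hn hk, fun χ hχ => ?_⟩
  obtain ⟨T, hs, ht, hT, hd, hd'⟩ := hχ.exists_T_diffeo hh hn hk
  have hM := hχ.image_T_M hs ht hT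
  refine ⟨T, hs, ht, fun p _ => hT p, hd, hd', hM, hM.trans ?_⟩
  ext p
  exact ⟨fun hp => ⟨⟨⟨hp.1.1, hp.2.1⟩, hp.1⟩, hp.2.2⟩, fun hp => ⟨hp.1.2, hp.1.1.2, hp.2⟩⟩
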